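/- Let $p\ge 0$ and $k_1,\dots,k_p\ge 0$ be integers, and let $V_0,V_1,\dots,V_p$ be complex vector spaces with $\dim V_i=k_i+1$, where $k_0=k_1+\dots+k_p$ (boundary format). An empty sum is $0$ and an empty tensor product is $\mathbb{C}$. An element $A\in V_0\otimes V_1\otimes\dots\otimes V_p$ is regarded both as a linear map $V_0^\vee\to V_1\otimes\dots\otimes V_p$ and, dually, as a linear map $V_1^\vee\otimes\dots\otimes V_p^\vee\to V_0$. It is called degenerate if there are nonzero $v_i\in V_i^\vee$ ($i=1,\dots,p$) with $A(v_1\otimes\dots\otimes v_p)=0$, and nondegenerate otherwise. Put $m_j=\sum_{i=1}^{j-1}k_i$ (so $m_1=0$) and $$N=\frac{(k_0+1)!}{k_1!\cdots k_p!}.$$ Let $$\partial_A: V_0^\vee\otimes S^{m_1}V_1\otimes\dots\otimes S^{m_p}V_p\to S^{m_1+1}V_1\otimes\dots\otimes S^{m_p+1}V_p$$ be the natural map, which sends $f\otimes s$ to the product of $A(f)\in V_1\otimes\dots\otimes V_p$ with $s$, taken factor by factor by means of the multiplications $V_i\otimes S^{m_i}V_i\to S^{m_i+1}V_i$. Then the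 source and the target of $\partial_A$ both have dimension $N$. Let $\det\partial_A$ be the determinant with respect to any fixed bases of source and target, which do not depend on $A$. Then the following hold. 1. $A$ is nondegenerate if and only if $\det\partial_A\ne 0$. 2. The degenerate matrices form an irreducible hypersurface of degree $N$ in the affine space $V_0\otimes V_1\otimes\dots\otimes V_p$, with equation $\det\partial_A=0$. More precisely, in linear coordinates on this space $A\mapsto\det\partial_A$ is an irreducible homogeneous polynomial of degree $N$, the set of degenerate matrices is its zero set and is irreducible in the Zariski topology, and this polynomial generates the ideal of all polynomials vanishing on the set of degenerate matrices. -/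

import Mathlib

open scoped TensorProduct

noncomputable section

namespace BoundaryFormat

open Module

/-- The symmetric power `S^m V`: the degree `m` part of the symmetric algebra of `V`,
that is, the span of all products of `m` vectors of `V`. -/
def symPow (V : Type*) [AddCommGroup V] [Module ℂ V] (m : ℕ) :
    Submodule ℂ (SymmetricAlgebra ℂ V) :=
  LinearMap.range (SymmetricAlgebra.ι ℂ V) ^ m

/-- The multiplication map `V × S^m V → S^{m+1} V` of the symmetric algebra. -/
def symMul (V : Type*) [AddCommGroup V] [Module ℂ V] (m : ℕ) :
    V →ₗ[ℂ] symPow V m →ₗ[ℂ] symPow V (m + 1) :=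
  LinearMap.mk₂ ℂ
    (fun v s => ⟨SymmetricAlgebra.ι ℂ V v * (s : SymmetricAlgebra ℂ V), by
      rw [symPow, pow_succ']
      exact Submodule.mul_mem_mul ⟨v, rfl⟩ s.2⟩)
    (fun v w s => Subtype.ext (by simp [add_mul]))
    (fun a v s => Subtype.ext (by simp))
    (fun v s t => Subtype.ext (by simp [mul_add]))
    (fun a v s => Subtype.ext (by simp))

section Matrices

variable {p : ℕ} {V₀ : Type*} {V : Fin p → Type*}
  [AddCommGroup V₀] [Module ℂ V₀] [∀ i, AddCommGroup (V i)] [∀ i, Module ℂ (V i)]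

variable (V₀ V) in
/-- Multidimensional matrices: the elements of `V₀ ⊗ V₁ ⊗ ⋯ ⊗ V_p`
(the spaces `V₁, …, V_p` are indexed by `Fin p`). -/
abbrev MultiMatrix : Type _ := V₀ ⊗[ℂ] (⨂[ℂ] i, V i)

/-- A multidimensional matrix regarded as a map `V₀^∨ → V₁ ⊗ ⋯ ⊗ V_p`. -/
def toMap (A : MultiMatrix V₀ V) : Dual ℂ V₀ →ₗ[ℂ] ⨂[ℂ] i, V i where
  toFun f := TensorProduct.lid ℂ _ (f.rTensor (⨂[ℂ] i, V i) A)
  map_add' f g := by simp [LinearMap.rTensor_add]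
  map_smul' a f := by simp [LinearMap.rTensor_smul]

theorem toMap_tmul (x : V₀) (t : ⨂[ℂ] i, V i) (f : Dual ℂ V₀) :
    toMap (x ⊗ₜ[ℂ] t) f = f x • t := by
  simp [toMap]

/-- The dual of `toMap A`: a multidimensional matrix regarded as a map
`V₁^∨ ⊗ ⋯ ⊗ V_p^∨ → V₀`. -/
def toDualMap (A : MultiMatrix V₀ V) : (⨂[ℂ] i, Dual ℂ (V i)) →ₗ[ℂ] V₀ where
  toFun w := TensorProduct.rid ℂ _ ((PiTensorProduct.dualDistrib w).lTensor V₀ A)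
  map_add' f g := by simp [LinearMap.lTensor_add]
  map_smul' a f := by simp [LinearMap.lTensor_smul]

theorem toDualMap_tmul_tprod (x : V₀) (y : ∀ i, V i) (v : ∀ i, Dual ℂ (V i)) :
    toDualMap (x ⊗ₜ[ℂ] PiTensorProduct.tprod ℂ y) (PiTensorProduct.tprod ℂ v) =
      (∏ i, v i (y i)) • x := by
  simp [toDualMap]

/-- `A` is degenerate if `A(v₁ ⊗ ⋯ ⊗ v_p) = 0` for some nonzero `v_i ∈ V_i^∨`. -/
def IsDegenerate (A : MultiMatrix V₀ V) : Prop :=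
  ∃ v : ∀ i, Dual ℂ (V i), (∀ i, v i ≠ 0) ∧ toDualMap A (PiTensorProduct.tprod ℂ v) = 0

/-- The numbers `m_j = k₁ + ⋯ + k_{j-1}`. -/
def mIdx (k : Fin p → ℕ) (j : Fin p) : ℕ := ∑ i ∈ Finset.Iio j, k i

variable (V₀ V) in
/-- `V₀^∨ ⊗ S^{m₁}V₁ ⊗ ⋯ ⊗ S^{m_p}V_p`. -/
abbrev Source (k : Fin p → ℕ) : Type _ :=
  Dual ℂ V₀ ⊗[ℂ] (⨂[ℂ] i, symPow (V i) (mIdx k i))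

variable (V) in
/-- `S^{m₁+1}V₁ ⊗ ⋯ ⊗ S^{m_p+1}V_p`. -/
abbrev Target (k : Fin p → ℕ) : Type _ :=
  ⨂[ℂ] i, symPow (V i) (mIdx k i + 1)

/-- The natural map `∂_A`: it sends `f ⊗ s` to the product of `A(f) ∈ V₁ ⊗ ⋯ ⊗ V_p` with
`s ∈ S^{m₁}V₁ ⊗ ⋯ ⊗ S^{m_p}V_p`, taken factor by factor in the symmetric algebras. -/
def del (k : Fin p → ℕ) (A : MultiMatrix V₀ V) : Source V₀ V k →ₗ[ℂ] Target V k :=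
  TensorProduct.lift
    (PiTensorProduct.map₂ (fun i => symMul (V i) (mIdx k i)) ∘ₗ toMap A)

theorem del_tmul_tprod (k : Fin p → ℕ) (x : V₀) (y : ∀ i, V i) (f : Dual ℂ V₀)
    (s : ∀ i, symPow (V i) (mIdx k i)) :
    del k (x ⊗ₜ[ℂ] PiTensorProduct.tprod ℂ y) (f ⊗ₜ[ℂ] PiTensorProduct.tprod ℂ s) =
      f x • PiTensorProduct.tprod ℂ (fun i => symMul (V i) (mIdx k i) (y i) (s i)) := by
  simp [del, toMap_tmul, PiTensorProduct.map₂_tprod_tprod]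

end Matrices

/-- `N = (k₀+1)! / (k₁! ⋯ k_p!)`. -/
def degN {p : ℕ} (k₀ : ℕ) (k : Fin p → ℕ) : ℕ := (k₀ + 1).factorial / ∏ i, (k i).factorial

/-- The division in the definition of `N` is exact. -/
theorem degN_mul {p : ℕ} (k₀ : ℕ) (k : Fin p → ℕ) (h : k₀ = ∑ i, k i) :
    degN k₀ k * ∏ i, (k i).factorial = (k₀ + 1).factorial := by
  subst h
  exact Nat.div_mul_cancel ((Nat.prod_factorial_dvd_factorial_sum _ _).trans
    (Nat.factorial_dvd_factorial (Nat.le_succ _)))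

/-- `Z` is an irreducible algebraic subset of affine space: it is the zero set of an ideal, it is
nonempty, and it is not covered by two algebraic sets unless one of them contains it. -/
def IsIrreducibleVariety {ι : Type*} (Z : Set (ι → ℂ)) : Prop :=
  (∃ I : Ideal (MvPolynomial ι ℂ), Z = MvPolynomial.zeroLocus ℂ I) ∧ Z.Nonempty ∧
    ∀ I J : Ideal (MvPolynomial ι ℂ),
      Z ⊆ MvPolynomial.zeroLocus ℂ I ∪ MvPolynomial.zeroLocus ℂ J →
        Z ⊆ MvPolynomial.zeroLocus ℂ I ∨ Z ⊆ MvPolynomial.zeroLocus ℂ J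

/-- `Z` is a hypersurface of degree `d` with (reduced) equation `P = 0`: the polynomial `P` has
degree `d ≥ 1`, `Z` is its zero set, and `P` generates the ideal of all polynomials vanishing
on `Z`. -/
def IsHypersurfaceWithEquation {ι : Type*} (Z : Set (ι → ℂ)) (P : MvPolynomial ι ℂ) (d : ℕ) :
    Prop :=
  P.totalDegree = d ∧ 1 ≤ d ∧ Z = {x | MvPolynomial.eval x P = 0} ∧
    MvPolynomial.vanishingIdeal ℂ Z = Ideal.span {P}

end BoundaryFormat

end

/-!
No cohomology is needed. Let `E = V₀ ⊗ V₁ ⊗ ⋯ ⊗ V_p`, let `Z ⊆ E` be the set of degenerate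
matrices and let `P` be the polynomial `A ↦ det ∂_A` of degree `N`. For any exponents
`r₁, …, r_p`, `mulMap r` is the analogue
`V₀^∨ ⊗ S^{r₁}V₁ ⊗ ⋯ ⊗ S^{r_p}V_p → S^{r₁+1}V₁ ⊗ ⋯ ⊗ S^{r_p+1}V_p` of `∂_A`. Its target consists
of the multihomogeneous polynomials on `V₁^∨ × ⋯ × V_p^∨`, and its image is the part of
multidegree `(r₁ + 1, …, r_p + 1)` of the ideal generated by the rows of `A`, which are
multilinear forms. So at a degenerate matrix all polynomials in the image have a common zero, and
`mulMap r A` is not surjective (`IsDegenerate.not_surjective`). In particular `P` vanishes on `Z`.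

* `Z` is irreducible: any two of its points lie on a polynomial curve contained in `Z`
  (`exists_curve_of_isDegenerate`), so that the ideal `I(Z)` is prime.
* `P` is irreducible. If the rows of `A` are decomposable tensors `⊗_i ℓ_i(j)`, where for each `i`
  the vectors `ℓ_i(0), …, ℓ_i(k₀)` are in general position in `V_i`, then `∂_A` is surjective
  (`mulMap_ofRows_surjective`), hence `P(A) ≠ 0`. Now let `P = QR`; as `I(Z)` is prime, one may
  assume that `Q ∈ I(Z)`. The degree of `P` in the `j`-th row is `d = k₀! / (k₁! ⋯ k_p!)`. There
  are also `d` ways of distributing the other `k₀` rows into groups of sizes `k₁, …, k_p`; each of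
  them gives a common zero of these rows, and `Q` vanishes when the `j`-th row takes the value `0`
  there. So on a generic line in the space of `j`-th rows `Q` already has `d` zeros, and `R` is
  constant (`eval_cofactor_update`). Hence `R` does not change if all the rows are multiplied by
  `t`, while `P` is multiplied by `t ^ N`; so `Q` has degree at least `N` (`degN_le_totalDegree`),
  and `R` is constant.
* `P` generates `I(Z)`. Suppose that some `G ∈ I(Z)` is not divisible by `P`. By Gauss's lemma a
  coordinate that occurs in `P` can be eliminated from `P` and `G`
  (`exists_mem_span_pair_eval_eq`): `I(Z)` contains a nonzero polynomial that is invariant under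
  translations in some direction `w`. But in boundary format the translates of `Z` along any
  `w ≠ 0` fill an open set, by a computation of a derivative, so such a polynomial is zero
  (`eq_zero_of_forall_isDegenerate`).
* The zero set of `P` is `Z`. If `A` is nondegenerate, then by the Nullstellensatz `mulMap r A` is
  surjective for some `r`; composed with a right inverse of this map, `mulMap r` has a determinant
  that is a polynomial in `I(Z)` with value `1` at `A`
  (`exists_eval_ne_zero_of_not_isDegenerate`). As it is a multiple of `P`, also `P(A) ≠ 0`.

The products of `n` among `n + k` vectors in general position in a space of dimension `k + 1` form
a basis of its `n`-th symmetric power (`exists_basis_symPow`). This yields the dimensions of the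
source and the target.
-/

noncomputable section

namespace BoundaryFormat

open Module

/-! ### Vectors in general position and bases of symmetric powers -/

section GeneralPosition

variable {V : Type*} [AddCommGroup V] [Module ℂ V]

/-- The vectors `ℓ j` are in general position in a space of dimension `k + 1`: no nonzero linear
form vanishes on `k + 1` of them, that is, any `k + 1` of them span the space. -/
def GeneralPosition {J : Type*} (k : ℕ) (ℓ : J → V) : Prop :=
  ∀ S : Finset J, k + 1 ≤ S.card → ∀ v : Dual ℂ V, (∀ j ∈ S, v (ℓ j) = 0) → v = 0

variable {J : Type*} {k : ℕ} {ℓ : J → V}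

theorem GeneralPosition.span_eq_top (h : GeneralPosition k ℓ) {S : Finset J}
    (hS : k + 1 ≤ S.card) : Submodule.span ℂ (ℓ '' S) = ⊤ := by
  by_contra hne
  obtain ⟨v, hv, hle⟩ := Submodule.exists_le_ker_of_lt_top _ (lt_top_iff_ne_top.2 hne)
  exact hv (h S hS v fun j hj => hle (Submodule.subset_span ⟨j, hj, rfl⟩))

theorem GeneralPosition.exists_dual (h : GeneralPosition k ℓ) (hV : finrank ℂ V = k + 1)
    {S : Finset J} (hS : S.card = k) :
    ∃ v : Dual ℂ V, ∀ j, v (ℓ j) = 0 ↔ j ∈ S := by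
  classical
  have : Module.Finite ℂ V := Module.finite_of_finrank_pos (by omega)
  have hlt : Submodule.span ℂ ((S.image ℓ : Finset V) : Set V) < ⊤ := by
    refine lt_top_iff_ne_top.2 fun htop => ?_
    have h1 := finrank_span_finset_le_card (R := ℂ) (S.image ℓ)
    have h2 : (S.image ℓ).card ≤ S.card := Finset.card_image_le
    rw [Set.finrank, htop, finrank_top] at h1
    omega
  obtain ⟨v, hv, hle⟩ := Submodule.exists_le_ker_of_lt_top _ hlt
  have hz : ∀ j ∈ S, v (ℓ j) = 0 := fun j hj =>
    hle (Submodule.subset_span (Finset.mem_coe.2 (Finset.mem_image_of_mem ℓ hj)))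
  refine ⟨v, fun j => ⟨fun hj => ?_, hz j⟩⟩
  by_contra hjS
  refine hv (h (insert j S) (by rw [Finset.card_insert_of_notMem hjS, hS]) v fun i hi => ?_)
  rcases Finset.mem_insert.1 hi with rfl | hi
  exacts [hj, hz i hi]

/-- Points of the moment curve are in general position. -/
theorem exists_generalPosition (hV : finrank ℂ V = k + 1) (n : ℕ) :
    ∃ ℓ : Fin n → V, GeneralPosition k ℓ := by
  have : Module.Finite ℂ V := Module.finite_of_finrank_pos (by omega)
  let β := Module.finBasisOfFinrankEq ℂ V hV
  refine ⟨fun j => ∑ a : Fin (k + 1), ((j : ℕ) : ℂ) ^ (a : ℕ) • β a, fun S hS v hv => ?_⟩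
  -- a linear form restricted to the moment curve is a polynomial of degree at most `k`
  let q : Polynomial ℂ := ∑ a : Fin (k + 1), Polynomial.C (v (β a)) * Polynomial.X ^ (a : ℕ)
  have hq : q = 0 := by
    refine Polynomial.eq_zero_of_natDegree_lt_card_of_eval_eq_zero' q
      (S.image fun j : Fin n => ((j : ℕ) : ℂ)) ?_ ?_
    · intro x hx
      obtain ⟨j, hj, rfl⟩ := Finset.mem_image.1 hx
      have := hv j hj
      simp only [map_sum, map_smul, smul_eq_mul] at this
      simp only [q, Polynomial.eval_finsetSum, Polynomial.eval_mul, Polynomial.eval_C,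
        Polynomial.eval_pow, Polynomial.eval_X]
      rw [← this]
      exact Finset.sum_congr rfl fun a _ => mul_comm _ _
    · rw [Finset.card_image_of_injective _ (fun a b hab => Fin.ext (by exact_mod_cast hab))]
      refine lt_of_le_of_lt (Polynomial.natDegree_sum_le_of_forall_le (n := k) _ _ ?_) hS
      intro a _
      exact (Polynomial.natDegree_C_mul_X_pow_le _ _).trans (by omega)
  refine β.ext fun a => ?_
  have := congrArg (fun r => Polynomial.coeff r (a : ℕ)) hq
  simpa [q, Polynomial.finsetSum_coeff, Polynomial.coeff_X_pow, Fin.val_inj] using this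

theorem prod_ι_mem_symPow (ℓ : J → V) (T : Finset J) :
    ∏ j ∈ T, SymmetricAlgebra.ι ℂ V (ℓ j) ∈ symPow V T.card := by
  classical
  induction T using Finset.induction_on with
  | empty => simp [symPow, Submodule.one_eq_range]
  | insert j T hj ih =>
    rw [Finset.prod_insert hj, Finset.card_insert_of_notMem hj, symPow, pow_succ']
    exact Submodule.mul_mem_mul ⟨_, rfl⟩ ih

/-- If there are at least `n + k` vectors in general position, then `S^n V` is spanned by their
products of `n` distinct factors: a further factor `y ∈ V` is a combination of the at least `k + 1`
vectors that have not been used yet. -/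
theorem GeneralPosition.symPow_le_span (h : GeneralPosition k ℓ) (n : ℕ) {U : Finset J}
    (hU : n + k ≤ U.card) :
    symPow V n ≤ Submodule.span ℂ {x | ∃ T ⊆ U, T.card = n ∧
      x = ∏ j ∈ T, SymmetricAlgebra.ι ℂ V (ℓ j)} := by
  classical
  induction n with
  | zero =>
    rw [symPow, pow_zero, Submodule.one_eq_span]
    refine Submodule.span_mono ?_
    rintro _ rfl
    exact ⟨∅, by simp, by simp, by simp⟩
  | succ n ih =>
    rw [symPow, pow_succ', Submodule.mul_le]
    rintro _ ⟨y, rfl⟩ s hs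
    have hs' := ih (by omega) hs
    clear hs
    induction hs' using Submodule.span_induction with
    | zero => simp
    | add a b _ _ ha hb => rw [mul_add]; exact Submodule.add_mem _ ha hb
    | smul c a _ ha => rw [mul_smul_comm]; exact Submodule.smul_mem _ _ ha
    | mem s hs =>
      obtain ⟨T, hTU, hT, rfl⟩ := hs
      have hy : y ∈ Submodule.span ℂ (ℓ '' (U \ T : Finset J)) := by
        rw [h.span_eq_top (by rw [Finset.card_sdiff_of_subset hTU]; omega)]
        trivial
      induction hy using Submodule.span_induction with
      | zero => simp
      | add a b _ _ ha hb => rw [map_add, add_mul]; exact Submodule.add_mem _ ha hb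
      | smul c a _ ha => rw [map_smul, smul_mul_assoc]; exact Submodule.smul_mem _ _ ha
      | mem y hy =>
        obtain ⟨j, hj, rfl⟩ := hy
        obtain ⟨hjU, hjT⟩ := Finset.mem_sdiff.1 (Finset.mem_coe.1 hj)
        refine Submodule.subset_span ⟨insert j T, Finset.insert_subset hjU hTU, ?_, ?_⟩
        · rw [Finset.card_insert_of_notMem hjT, hT]
        · rw [Finset.prod_insert hjT]

/-- The products of `n` out of `n + k` vectors in general position form a basis of `S^n V`. -/
theorem exists_basis_symPow (hV : finrank ℂ V = k + 1) (n : ℕ) :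
    Nonempty (Basis (Finset.powersetCard n (Finset.univ : Finset (Fin (n + k)))) ℂ
      (symPow V n)) := by
  classical
  obtain ⟨ℓ, hℓ⟩ := exists_generalPosition hV (n + k)
  let f : Finset.powersetCard n (Finset.univ : Finset (Fin (n + k))) → symPow V n := fun T =>
    ⟨∏ j ∈ T.1, SymmetricAlgebra.ι ℂ V (ℓ j), by
      have := prod_ι_mem_symPow ℓ T.1
      rwa [(Finset.mem_powersetCard.1 T.2).2] at this⟩
  have hcard : ∀ T : Finset.powersetCard n (Finset.univ : Finset (Fin (n + k))),
      (T.1)ᶜ.card = k := fun T => by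
    rw [Finset.card_compl, (Finset.mem_powersetCard.1 T.2).2, Fintype.card_fin]; omega
  choose v hv using fun T => hℓ.exists_dual hV (hcard T)
  -- evaluation at `v T` kills all the products except the one indexed by `T`
  have hev : ∀ T T', SymmetricAlgebra.lift (v T) (f T' : SymmetricAlgebra ℂ V) ≠ 0 ↔ T' = T := by
    intro T T'
    have hTT : T'.1 ⊆ T.1 ↔ T' = T := by
      refine ⟨fun h => Subtype.ext (Finset.eq_of_subset_of_card_le h ?_), fun h => h ▸ subset_rfl⟩
      rw [(Finset.mem_powersetCard.1 T.2).2, (Finset.mem_powersetCard.1 T'.2).2]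
    rw [← hTT]
    simp only [f, map_prod, SymmetricAlgebra.lift_ι_apply, Finset.prod_ne_zero_iff, ne_eq, hv,
      Finset.mem_compl, not_not]
    rfl
  refine ⟨Basis.mk (v := f) ?_ ?_⟩
  · rw [Fintype.linearIndependent_iff]
    intro g hg T
    have h1 := congrArg (fun s : symPow V n =>
      SymmetricAlgebra.lift (v T) (s : SymmetricAlgebra ℂ V)) hg
    simp only [Submodule.coe_sum, Submodule.coe_smul, map_sum, map_smul, Submodule.coe_zero,
      map_zero] at h1
    rw [Finset.sum_eq_single T (fun T' _ hne => by
      rw [not_ne_iff.1 (mt (hev T T').1 hne), smul_zero]) (by simp)] at h1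
    exact (smul_eq_zero.1 h1).resolve_right ((hev T T).2 rfl)
  · rintro ⟨s, hs⟩ -
    have h1 := hℓ.symPow_le_span n (U := Finset.univ) (by simp) hs
    have h2 : {x | ∃ T ⊆ (Finset.univ : Finset (Fin (n + k))), T.card = n ∧
        x = ∏ j ∈ T, SymmetricAlgebra.ι ℂ V (ℓ j)} ⊆ (symPow V n).subtype '' Set.range f := by
      rintro _ ⟨T, -, hT, rfl⟩
      exact ⟨_, ⟨⟨T, by simp [Finset.mem_powersetCard, hT]⟩, rfl⟩, rfl⟩
    have h3 := Submodule.span_mono h2 h1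
    rw [← Submodule.map_span] at h3
    obtain ⟨x, hx, hxs⟩ := h3
    have hx' : x = ⟨s, hs⟩ := Subtype.ext hxs
    rwa [← hx']

theorem finrank_symPow (hV : finrank ℂ V = k + 1) (n : ℕ) :
    finrank ℂ (symPow V n) = (n + k).choose n := by
  obtain ⟨b⟩ := exists_basis_symPow hV n
  rw [finrank_eq_card_basis b]
  simp

theorem finite_symPow (hV : finrank ℂ V = k + 1) (n : ℕ) : Module.Finite ℂ (symPow V n) := by
  obtain ⟨b⟩ := exists_basis_symPow hV n
  exact Module.Finite.of_basis b

end GeneralPosition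

theorem finrank_piTensorProduct {ι : Type*} [Fintype ι] (M : ι → Type*)
    [∀ i, AddCommGroup (M i)] [∀ i, Module ℂ (M i)] [∀ i, Module.Finite ℂ (M i)] :
    finrank ℂ (⨂[ℂ] i, M i) = ∏ i, finrank ℂ (M i) := by
  classical
  rw [finrank_eq_card_basis (Basis.piTensorProduct fun i => Module.finBasis ℂ (M i))]
  simp

/-! ### Multiplication maps and evaluation at points -/

section MultiplicationMap

variable {p : ℕ} {V₀ : Type*} {V : Fin p → Type*}
  [AddCommGroup V₀] [Module ℂ V₀] [∀ i, AddCommGroup (V i)] [∀ i, Module ℂ (V i)]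

/-- The value of a multidimensional matrix `A ∈ V₀ ⊗ V₁ ⊗ ⋯ ⊗ V_p` at linear forms
`v_i ∈ V_i^∨`, as a linear function of `A`. -/
def contract (v : ∀ i, Dual ℂ (V i)) : MultiMatrix V₀ V →ₗ[ℂ] V₀ :=
  TensorProduct.rid ℂ V₀ ∘ₗ
    (PiTensorProduct.dualDistrib (PiTensorProduct.tprod ℂ v)).lTensor V₀

theorem toDualMap_tprod (A : MultiMatrix V₀ V) (v : ∀ i, Dual ℂ (V i)) :
    toDualMap A (PiTensorProduct.tprod ℂ v) = contract v A := rfl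

theorem contract_tmul (x : V₀) (w : ⨂[ℂ] i, V i) (v : ∀ i, Dual ℂ (V i)) :
    contract v (x ⊗ₜ[ℂ] w) = PiTensorProduct.dualDistrib (PiTensorProduct.tprod ℂ v) w • x := by
  simp [contract]

theorem apply_contract (A : MultiMatrix V₀ V) (v : ∀ i, Dual ℂ (V i)) (f : Dual ℂ V₀) :
    f (contract v A) =
      PiTensorProduct.dualDistrib (PiTensorProduct.tprod ℂ v) (toMap A f) := by
  induction A using TensorProduct.induction_on with
  | zero => simp [toMap]
  | tmul x t => rw [contract_tmul, toMap_tmul]; simp [mul_comm]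
  | add A B hA hB =>
    have : toMap (A + B) f = toMap A f + toMap B f := by simp [toMap]
    rw [map_add, map_add, hA, hB, this, map_add]

/-- The analogue of `∂_A` with arbitrary exponents `r_i`: the natural map
`V₀^∨ ⊗ S^{r₁}V₁ ⊗ ⋯ ⊗ S^{r_p}V_p → S^{r₁+1}V₁ ⊗ ⋯ ⊗ S^{r_p+1}V_p`, as a linear function
of `A`. -/
def mulMap (r : Fin p → ℕ) : MultiMatrix V₀ V →ₗ[ℂ]
    (Dual ℂ V₀ ⊗[ℂ] (⨂[ℂ] i, symPow (V i) (r i))) →ₗ[ℂ] ⨂[ℂ] i, symPow (V i) (r i + 1) where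
  toFun A := TensorProduct.lift
    (PiTensorProduct.map₂ (fun i => symMul (V i) (r i)) ∘ₗ toMap A)
  map_add' A B := by
    have : toMap (A + B) = toMap A + toMap B := by ext f; simp [toMap]
    rw [this]; ext f s; simp
  map_smul' c A := by
    have : toMap (c • A) = c • toMap A := by ext f; simp [toMap]
    rw [this]; ext f s; simp

theorem mulMap_tmul (r : Fin p → ℕ) (A : MultiMatrix V₀ V) (f : Dual ℂ V₀)
    (s : ⨂[ℂ] i, symPow (V i) (r i)) :
    mulMap r A (f ⊗ₜ[ℂ] s) =
      PiTensorProduct.map₂ (fun i => symMul (V i) (r i)) (toMap A f) s := by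
  simp [mulMap]

/-- Evaluation of elements of `S^{r₁}V₁ ⊗ ⋯ ⊗ S^{r_p}V_p`, regarded as multihomogeneous
polynomials, at points `v_i ∈ V_i^∨`. -/
def evalAt (r : Fin p → ℕ) (v : ∀ i, Dual ℂ (V i)) : (⨂[ℂ] i, symPow (V i) (r i)) →ₗ[ℂ] ℂ :=
  PiTensorProduct.dualDistrib (PiTensorProduct.tprod ℂ fun i =>
    (SymmetricAlgebra.lift (v i)).toLinearMap ∘ₗ (symPow (V i) (r i)).subtype)

theorem evalAt_tprod (r : Fin p → ℕ) (v : ∀ i, Dual ℂ (V i)) (s : ∀ i, symPow (V i) (r i)) :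
    evalAt r v (PiTensorProduct.tprod ℂ s) =
      ∏ i, SymmetricAlgebra.lift (v i) (s i : SymmetricAlgebra ℂ (V i)) := by
  simp [evalAt]

/-- Evaluation at a point is multiplicative. -/
theorem evalAt_map₂ (r : Fin p → ℕ) (v : ∀ i, Dual ℂ (V i)) (w : ⨂[ℂ] i, V i)
    (s : ⨂[ℂ] i, symPow (V i) (r i)) :
    evalAt (fun i => r i + 1) v (PiTensorProduct.map₂ (fun i => symMul (V i) (r i)) w s) =
      PiTensorProduct.dualDistrib (PiTensorProduct.tprod ℂ v) w * evalAt r v s := by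
  induction w using PiTensorProduct.induction_on with
  | smul_tprod c w =>
    induction s using PiTensorProduct.induction_on with
    | smul_tprod c' s =>
      have : ∀ i, SymmetricAlgebra.lift (v i)
          ((symMul (V i) (r i) (w i) (s i) : symPow (V i) (r i + 1)) : SymmetricAlgebra ℂ (V i)) =
          v i (w i) * SymmetricAlgebra.lift (v i) (s i : SymmetricAlgebra ℂ (V i)) := fun i => by
        simp [symMul]
      simp only [map_smul, LinearMap.smul_apply, PiTensorProduct.map₂_tprod_tprod, evalAt_tprod,
        this, Finset.prod_mul_distrib, PiTensorProduct.dualDistrib_apply, smul_eq_mul]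
      ring
    | add s t hs ht => simp only [map_add, hs, ht, mul_add]
  | add w w' hw hw' => simp only [map_add, LinearMap.add_apply, hw, hw', add_mul]

theorem evalAt_mulMap (r : Fin p → ℕ) (v : ∀ i, Dual ℂ (V i)) (A : MultiMatrix V₀ V)
    (hA : contract v A = 0) (z : Dual ℂ V₀ ⊗[ℂ] (⨂[ℂ] i, symPow (V i) (r i))) :
    evalAt (fun i => r i + 1) v (mulMap r A z) = 0 := by
  induction z using TensorProduct.induction_on with
  | zero => simp
  | tmul f s => rw [mulMap_tmul, evalAt_map₂, ← apply_contract, hA, map_zero, zero_mul]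
  | add x y hx hy => rw [map_add, map_add, hx, hy, add_zero]

theorem exists_apply_eq_one {W : Type*} [AddCommGroup W] [Module ℂ W] {v : Dual ℂ W}
    (hv : v ≠ 0) : ∃ y, v y = 1 := by
  obtain ⟨x, hx⟩ : ∃ x, v x ≠ 0 := by
    by_contra! h
    exact hv (LinearMap.ext h)
  exact ⟨(v x)⁻¹ • x, by simp [hx]⟩

theorem exists_evalAt_eq_one (r : Fin p → ℕ) (v : ∀ i, Dual ℂ (V i)) (hv : ∀ i, v i ≠ 0) :
    ∃ t, evalAt r v t = 1 := by
  choose y hy using fun i => exists_apply_eq_one (hv i)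
  refine ⟨PiTensorProduct.tprod ℂ fun i => ⟨SymmetricAlgebra.ι ℂ (V i) (y i) ^ r i,
    Submodule.pow_mem_pow (LinearMap.range (SymmetricAlgebra.ι ℂ (V i)))
      (LinearMap.mem_range_self _ _) _⟩, ?_⟩
  simp [evalAt_tprod, hy]

/-- At a degenerate matrix the image of the multiplication map consists of multihomogeneous
polynomials with a common zero. -/
theorem IsDegenerate.not_surjective {A : MultiMatrix V₀ V} (hA : IsDegenerate A)
    (r : Fin p → ℕ) : ¬ Function.Surjective (mulMap r A) := by
  intro hs
  obtain ⟨v, hv, hAv⟩ := hA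
  obtain ⟨t, ht⟩ := exists_evalAt_eq_one (fun i => r i + 1) v hv
  obtain ⟨z, rfl⟩ := hs t
  rw [evalAt_mulMap r v A hAv] at ht
  exact zero_ne_one ht

end MultiplicationMap

/-! ### Matrices whose rows are decomposable tensors in general position -/

section Rows

variable {p : ℕ} {V₀ : Type*} {V : Fin p → Type*}
  [AddCommGroup V₀] [Module ℂ V₀] [∀ i, AddCommGroup (V i)] [∀ i, Module ℂ (V i)]

/-- The multidimensional matrix with rows `F j ∈ V₁ ⊗ ⋯ ⊗ V_p`, with respect to a basis
of `V₀`. -/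
def ofRows {n : ℕ} (b : Basis (Fin n) ℂ V₀) (F : Fin n → ⨂[ℂ] i, V i) : MultiMatrix V₀ V :=
  ∑ j, b j ⊗ₜ[ℂ] F j

variable {n : ℕ} (b : Basis (Fin n) ℂ V₀) (F : Fin n → ⨂[ℂ] i, V i)

theorem toMap_ofRows (j : Fin n) : toMap (ofRows b F) (b.coord j) = F j := by
  classical
  have h : ∀ (A : MultiMatrix V₀ V) (f : Dual ℂ V₀),
      toMap A f = TensorProduct.lid ℂ _ (f.rTensor (⨂[ℂ] i, V i) A) := fun _ _ => rfl
  simp [h, ofRows, Finsupp.single_apply, ite_smul]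

theorem contract_ofRows_eq_zero_iff (v : ∀ i, Dual ℂ (V i)) :
    contract v (ofRows b F) = 0 ↔
      ∀ j, PiTensorProduct.dualDistrib (PiTensorProduct.tprod ℂ v) (F j) = 0 := by
  rw [← b.forall_coord_eq_zero_iff]
  simp only [apply_contract, toMap_ofRows]

/-- The partial sums `k₁ + ⋯ + k_q`. -/
def partialSum (k : Fin p → ℕ) (q : ℕ) : ℕ := ∑ i with i.val < q, k i

theorem mIdx_eq_partialSum (k : Fin p → ℕ) (i : Fin p) : mIdx k i = partialSum k i := by
  unfold mIdx partialSum
  congr 1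
  ext j
  simp

theorem partialSum_succ (k : Fin p → ℕ) (i : Fin p) :
    partialSum k (i + 1) = partialSum k i + k i := by
  unfold partialSum
  have : (Finset.univ.filter fun j : Fin p => j.val < i + 1) =
      insert i (Finset.univ.filter fun j : Fin p => j.val < i) := by
    ext j
    simp only [Finset.mem_filter, Finset.mem_univ, true_and, Finset.mem_insert, Fin.ext_iff]
    omega
  rw [this, Finset.sum_insert (by simp), add_comm]

theorem partialSum_self (k : Fin p → ℕ) : partialSum k p = ∑ i, k i := by
  simp [partialSum]

/-- For rows proportional to `⊗_i ℓ_i(j)`, with the `ℓ_i(j)` in general position, the image of the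
multiplication map contains every `⊗_i s_i` such that for all `i ≥ q` the factor `s_i` is divisible
by the product of the `ℓ_i(j)` over a common set of `m_q + 1` indices `j`. For `q = 0` this holds
since `⊗_i s_i` is divisible by a row; for `q = p` it is no condition on the `s_i`. -/
theorem tprod_mem_range_mulMap {k : Fin p → ℕ} {ℓ : ∀ i, Fin n → V i}
    (hℓ : ∀ i, GeneralPosition (k i) (ℓ i)) {c : Fin n → ℂ} (hc : ∀ j, c j ≠ 0)
    (q : ℕ) (hq : q ≤ p) (s : ∀ i, symPow (V i) (mIdx k i + 1)) (T : Finset (Fin n))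
    (hT : T.card = partialSum k q + 1)
    (hs : ∀ i : Fin p, q ≤ i → ∃ T' : Finset (Fin n), T ⊆ T' ∧ T'.card = mIdx k i + 1 ∧
      (s i : SymmetricAlgebra ℂ (V i)) = ∏ j ∈ T', SymmetricAlgebra.ι ℂ (V i) (ℓ i j)) :
    PiTensorProduct.tprod ℂ s ∈ LinearMap.range (mulMap (mIdx k)
      (ofRows b fun j => c j • PiTensorProduct.tprod ℂ fun i => ℓ i j)) := by
  classical
  induction q generalizing s T with
  | zero =>
    obtain ⟨j, rfl⟩ := Finset.card_eq_one.1 (show T.card = 1 by simpa [partialSum] using hT)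
    choose T' hT' hcard hs' using fun i => hs i (Nat.zero_le _)
    have hj : ∀ i, j ∈ T' i := fun i => hT' i (Finset.mem_singleton_self j)
    refine ⟨((c j)⁻¹ • b.coord j) ⊗ₜ[ℂ] PiTensorProduct.tprod ℂ fun i =>
      ⟨∏ l ∈ (T' i).erase j, SymmetricAlgebra.ι ℂ (V i) (ℓ i l), ?_⟩, ?_⟩
    · have := prod_ι_mem_symPow (ℓ i) ((T' i).erase j)
      rwa [Finset.card_erase_of_mem (hj i), hcard i, Nat.add_sub_cancel] at this
    · rw [mulMap_tmul, map_smul, toMap_ofRows, smul_smul, inv_mul_cancel₀ (hc j), one_smul,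
        PiTensorProduct.map₂_tprod_tprod]
      congr 1
      ext i
      rw [hs' i]
      exact Finset.mul_prod_erase (T' i) (fun l => SymmetricAlgebra.ι ℂ (V i) (ℓ i l)) (hj i)
  | succ q ih =>
    let i₀ : Fin p := ⟨q, hq⟩
    set R := LinearMap.range (mulMap (mIdx k)
      (ofRows b fun j => c j • PiTensorProduct.tprod ℂ fun i => ℓ i j)) with hR
    let N : Submodule ℂ (symPow (V i₀) (mIdx k i₀ + 1)) :=
      R.comap ((PiTensorProduct.tprod ℂ).toLinearMap s i₀)
    have hcard : mIdx k i₀ + 1 + k i₀ ≤ T.card := by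
      rw [hT, mIdx_eq_partialSum]
      have := partialSum_succ k i₀
      simp only [i₀] at this ⊢
      omega
    have hle := ((hℓ i₀).symPow_le_span (mIdx k i₀ + 1) hcard).trans
      (Submodule.span_le (p := N.map (symPow (V i₀) (mIdx k i₀ + 1)).subtype).2 (by
        rintro _ ⟨T', hT', hcard', rfl⟩
        refine ⟨⟨∏ j ∈ T', SymmetricAlgebra.ι ℂ (V i₀) (ℓ i₀ j), ?_⟩, ?_, rfl⟩
        · have := prod_ι_mem_symPow (ℓ i₀) T'
          rwa [hcard'] at this
        · refine ih (Nat.le_of_lt hq) (Function.update s i₀ _) T'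
            (by rw [hcard', mIdx_eq_partialSum]) fun i hi => ?_
          rcases eq_or_ne i i₀ with rfl | hne
          · exact ⟨T', subset_rfl, hcard', by simp⟩
          · obtain ⟨T'', h1, h2, h3⟩ := hs i
              (lt_of_le_of_ne hi fun h => hne (Fin.ext h.symm))
            exact ⟨T'', hT'.trans h1, h2, by rw [Function.update_of_ne hne]; exact h3⟩))
    obtain ⟨x, hx, hxs⟩ := hle (s i₀).2
    have hx' : x = s i₀ := Subtype.ext hxs
    rw [hx'] at hx
    simpa [N] using hx

/-- Matrices with decomposable rows in general position have a surjective `∂_A`. -/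
theorem mulMap_ofRows_surjective {k₀ : ℕ} {k : Fin p → ℕ} (hk : k₀ = ∑ i, k i)
    (b : Basis (Fin (k₀ + 1)) ℂ V₀) {ℓ : ∀ i, Fin (k₀ + 1) → V i}
    (hℓ : ∀ i, GeneralPosition (k i) (ℓ i)) {c : Fin (k₀ + 1) → ℂ} (hc : ∀ j, c j ≠ 0) :
    Function.Surjective (mulMap (mIdx k)
      (ofRows b fun j => c j • PiTensorProduct.tprod ℂ fun i => ℓ i j)) := by
  rw [← LinearMap.range_eq_top, eq_top_iff, ← PiTensorProduct.span_tprod_eq_top, Submodule.span_le]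
  rintro _ ⟨s, rfl⟩
  refine tprod_mem_range_mulMap b hℓ hc p le_rfl s Finset.univ ?_ fun i hi => ?_
  · rw [partialSum_self, ← hk, Finset.card_fin]
  · exact absurd i.2 (not_lt.2 hi)

end Rows

/-! ### Dimensions of the source and the target -/

section Dimensions

variable {p : ℕ} (k : Fin p → ℕ)

theorem prod_choose_mul_prod_factorial (a : ℕ) :
    (∏ i, (mIdx k i + a + k i).choose (mIdx k i + a)) * (∏ i, (k i).factorial) * a.factorial =
      (∑ i, k i + a).factorial := by
  have h : ∀ q ≤ p, (∏ i : Fin p with i.val < q,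
      ((mIdx k i + a + k i).choose (mIdx k i + a) * (k i).factorial)) * a.factorial =
        (partialSum k q + a).factorial := by
    intro q hq
    induction q with
    | zero => simp [partialSum]
    | succ q ih =>
      let i₀ : Fin p := ⟨q, hq⟩
      have hins : (Finset.univ.filter fun j : Fin p => j.val < q + 1) =
          insert i₀ (Finset.univ.filter fun j : Fin p => j.val < q) := by
        ext j
        simp only [Finset.mem_filter, Finset.mem_univ, true_and, Finset.mem_insert, Fin.ext_iff, i₀]
        omega
      have hsucc : partialSum k (q + 1) = partialSum k q + k i₀ := partialSum_succ k i₀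
      have hM : mIdx k i₀ = partialSum k q := mIdx_eq_partialSum k i₀
      rw [hins, Finset.prod_insert (by simp [i₀]), mul_assoc, ih (Nat.le_of_lt hq), hM, hsucc,
        show partialSum k q + k i₀ + a = partialSum k q + a + k i₀ by omega,
        ← Nat.add_choose_mul_factorial_mul_factorial (partialSum k q + a) (k i₀),
        Nat.choose_symm_add]
      ring
  rw [← Finset.prod_mul_distrib, ← partialSum_self, ← h p le_rfl]
  simp

theorem finrank_tensor_symPow {V : Fin p → Type*}
    [∀ i, AddCommGroup (V i)] [∀ i, Module ℂ (V i)] (hV : ∀ i, finrank ℂ (V i) = k i + 1)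
    (a : ℕ) : finrank ℂ (⨂[ℂ] i, symPow (V i) (mIdx k i + a)) * (∏ i, (k i).factorial) *
      a.factorial = (∑ i, k i + a).factorial := by
  have := fun i => finite_symPow (hV i) (mIdx k i + a)
  rw [finrank_piTensorProduct, ← prod_choose_mul_prod_factorial]
  simp only [fun i => finrank_symPow (hV i) (mIdx k i + a)]

variable {k} {k₀ : ℕ} {V₀ : Type*} {V : Fin p → Type*}
  [AddCommGroup V₀] [Module ℂ V₀] [∀ i, AddCommGroup (V i)] [∀ i, Module ℂ (V i)]

theorem prod_factorial_pos : 0 < ∏ i, (k i).factorial :=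
  Finset.prod_pos fun _ _ => Nat.factorial_pos _

theorem finrank_target (hk : k₀ = ∑ i, k i) (hV : ∀ i, finrank ℂ (V i) = k i + 1) :
    finrank ℂ (Target V k) = degN k₀ k := by
  have h := finrank_tensor_symPow k hV 1
  rw [← hk, ← degN_mul k₀ k hk, Nat.factorial_one, mul_one] at h
  exact Nat.eq_of_mul_eq_mul_right prod_factorial_pos h

theorem finrank_tensor_symPow_mul (hk : k₀ = ∑ i, k i) (hV : ∀ i, finrank ℂ (V i) = k i + 1) :
    finrank ℂ (⨂[ℂ] i, symPow (V i) (mIdx k i)) * ∏ i, (k i).factorial = k₀.factorial := by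
  have h := finrank_tensor_symPow k hV 0
  simpa [← hk] using h

theorem succ_mul_finrank_tensor_symPow (hk : k₀ = ∑ i, k i)
    (hV : ∀ i, finrank ℂ (V i) = k i + 1) :
    (k₀ + 1) * finrank ℂ (⨂[ℂ] i, symPow (V i) (mIdx k i)) = degN k₀ k := by
  refine Nat.eq_of_mul_eq_mul_right (prod_factorial_pos (k := k)) ?_
  rw [mul_assoc, finrank_tensor_symPow_mul hk hV, degN_mul k₀ k hk, Nat.factorial_succ]

theorem free_tensor_symPow (r : Fin p → ℕ) :
    Module.Free ℂ (⨂[ℂ] i, symPow (V i) (r i)) :=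
  Module.Free.of_basis (Basis.piTensorProduct fun i => Basis.ofVectorSpace ℂ (symPow (V i) (r i)))

theorem finrank_source (hk : k₀ = ∑ i, k i) (hV₀ : finrank ℂ V₀ = k₀ + 1)
    (hV : ∀ i, finrank ℂ (V i) = k i + 1) :
    finrank ℂ (Source V₀ V k) = degN k₀ k := by
  have := free_tensor_symPow (V := V) (mIdx k)
  rw [finrank_tensorProduct, Subspace.dual_finrank_eq, hV₀,
    succ_mul_finrank_tensor_symPow hk hV]

end Dimensions

/-! ### Polynomial functions on vector spaces -/

section Polynomials

variable {E ι : Type*} [AddCommGroup E] [Module ℂ E]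

/-- The polynomial curves `t ↦ ∑ tⁿ • aₙ` in a vector space. -/
def polyCurves (E : Type*) [AddCommGroup E] [Module ℂ E] : Submodule ℂ (ℂ → E) :=
  Submodule.span ℂ {γ | ∃ (n : ℕ) (a : E), γ = fun t => t ^ n • a}

theorem pow_smul_mem_polyCurves (n : ℕ) (a : E) : (fun t : ℂ => t ^ n • a) ∈ polyCurves E :=
  Submodule.subset_span ⟨n, a, rfl⟩

theorem const_mem_polyCurves (a : E) : (fun _ : ℂ => a) ∈ polyCurves E := by
  simpa using pow_smul_mem_polyCurves 0 a

theorem pow_smul_mem_polyCurves_of_mem {γ : ℂ → E} (hγ : γ ∈ polyCurves E) (m : ℕ) :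
    (fun t => t ^ m • γ t) ∈ polyCurves E := by
  induction hγ using Submodule.span_induction with
  | zero =>
    simp only [Pi.zero_apply, smul_zero]
    exact (polyCurves E).zero_mem
  | add γ δ _ _ h1 h2 =>
    simp only [Pi.add_apply, smul_add]
    exact (polyCurves E).add_mem h1 h2
  | smul c γ _ h =>
    simp only [Pi.smul_apply, smul_comm _ c]
    exact (polyCurves E).smul_mem c h
  | mem γ h =>
    obtain ⟨n, a, rfl⟩ := h
    simp only [smul_smul, ← pow_add]
    exact pow_smul_mem_polyCurves _ _

theorem map_mem_polyCurves {F : Type*} [AddCommGroup F] [Module ℂ F] (L : E →ₗ[ℂ] F)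
    {γ : ℂ → E} (hγ : γ ∈ polyCurves E) : (fun t => L (γ t)) ∈ polyCurves F := by
  induction hγ using Submodule.span_induction with
  | zero =>
    simp only [Pi.zero_apply, map_zero]
    exact (polyCurves F).zero_mem
  | add γ δ _ _ h1 h2 =>
    simp only [Pi.add_apply, map_add]
    exact (polyCurves F).add_mem h1 h2
  | smul c γ _ h =>
    simp only [Pi.smul_apply, map_smul]
    exact (polyCurves F).smul_mem c h
  | mem γ h =>
    obtain ⟨n, a, rfl⟩ := h
    simp only [map_smul]
    exact pow_smul_mem_polyCurves _ _

theorem sub_mem_polyCurves {γ δ : ℂ → E} (hγ : γ ∈ polyCurves E) (hδ : δ ∈ polyCurves E) :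
    (fun t => γ t - δ t) ∈ polyCurves E :=
  (polyCurves E).sub_mem hγ hδ

theorem add_smul_mem_polyCurves (a b : E) : (fun t : ℂ => a + t • b) ∈ polyCurves E :=
  (polyCurves E).add_mem (const_mem_polyCurves a) (by simpa using pow_smul_mem_polyCurves 1 b)

theorem exists_polynomial_of_mem_polyCurves {γ : ℂ → ℂ} (hγ : γ ∈ polyCurves ℂ) :
    ∃ q : Polynomial ℂ, ∀ t, q.eval t = γ t := by
  induction hγ using Submodule.span_induction with
  | zero => exact ⟨0, by simp⟩
  | add γ δ _ _ h1 h2 =>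
    obtain ⟨q, hq⟩ := h1
    obtain ⟨r, hr⟩ := h2
    exact ⟨q + r, by simp [hq, hr]⟩
  | smul c γ _ h =>
    obtain ⟨q, hq⟩ := h
    exact ⟨Polynomial.C c * q, by simp [hq]⟩
  | mem γ h =>
    obtain ⟨n, a, rfl⟩ := h
    exact ⟨Polynomial.X ^ n * Polynomial.C a, fun t => by
      simp only [Polynomial.eval_mul, Polynomial.eval_pow, Polynomial.eval_X, Polynomial.eval_C,
        smul_eq_mul]⟩

/-- The restriction of a polynomial to a polynomial curve is a polynomial in one variable. -/
theorem exists_eval_curve (e : Basis ι ℂ E) {γ : ℂ → E} (hγ : γ ∈ polyCurves E) :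
    ∃ φ : MvPolynomial ι ℂ →ₐ[ℂ] Polynomial ℂ,
      ∀ (Q : MvPolynomial ι ℂ) (t : ℂ), (φ Q).eval t = MvPolynomial.eval (e.repr (γ t)) Q := by
  choose q hq using fun i => exists_polynomial_of_mem_polyCurves
    (map_mem_polyCurves (e.coord i) hγ)
  refine ⟨MvPolynomial.aeval q, fun Q t => ?_⟩
  have h : (Polynomial.evalRingHom t).comp (MvPolynomial.aeval q).toRingHom =
      MvPolynomial.eval (e.repr (γ t)) := by
    apply MvPolynomial.ringHom_ext
    · intro c; simp
    · intro i; simp [hq]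
  exact congrArg (fun f => f Q) h

/-- The determinant of a matrix depending linearly on a vector is a form in the coordinates of
the vector. -/
theorem exists_det_polynomial [Fintype ι] (e : Basis ι ℂ E) {n : Type*} [Fintype n]
    [DecidableEq n] (Λ : E →ₗ[ℂ] Matrix n n ℂ) :
    ∃ P : MvPolynomial ι ℂ, (∀ A, MvPolynomial.eval (e.repr A) P = (Λ A).det) ∧
      P.IsHomogeneous (Fintype.card n) := by
  let M : Matrix n n (MvPolynomial ι ℂ) := Matrix.of fun i j =>
    ∑ x, MvPolynomial.C (Λ (e x) i j) * MvPolynomial.X x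
  refine ⟨M.det, fun A => ?_, ?_⟩
  · rw [RingHom.map_det]
    congr 1
    ext i j
    have h := congrArg (fun B => Λ B i j) (e.sum_repr A)
    simp only [map_sum, map_smul, Matrix.sum_apply, Matrix.smul_apply, smul_eq_mul] at h
    simp [M, ← h, mul_comm]
  · rw [Matrix.det_apply]
    refine MvPolynomial.IsHomogeneous.sum _ _ _ fun σ _ => ?_
    have h : (∏ i, M (σ i) i).IsHomogeneous (∑ _i : n, 1) :=
      MvPolynomial.IsHomogeneous.prod _ _ _ fun i _ => MvPolynomial.IsHomogeneous.sum _ _ _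
        fun x _ => by simpa using (MvPolynomial.isHomogeneous_C_mul_X (R := ℂ) _ x)
    rw [Finset.sum_const, Finset.card_univ, smul_eq_mul, mul_one] at h
    rcases Int.units_eq_one_or (Equiv.Perm.sign σ) with hs | hs
    · rw [hs, one_smul]; exact h
    · rw [hs, Units.neg_smul, one_smul]; exact h.neg

/-- If `q` has `d` distinct roots and `q * r` has degree at most `d`, then `r` is constant. -/
theorem eval_eq_eval_of_card_roots_le {q r : Polynomial ℂ} {d : ℕ} (hne : q * r ≠ 0)
    (hdeg : (q * r).natDegree ≤ d) {S : Finset ℂ} (hS : ∀ t ∈ S, q.eval t = 0)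
    (hd : d ≤ S.card) (s t : ℂ) : r.eval s = r.eval t := by
  have hq : q ≠ 0 := left_ne_zero_of_mul hne
  have hr : r ≠ 0 := right_ne_zero_of_mul hne
  have h1 : S.card ≤ q.natDegree := by
    by_contra! h
    exact hq (Polynomial.eq_zero_of_natDegree_lt_card_of_eval_eq_zero' q S hS h)
  rw [Polynomial.natDegree_mul hq hr] at hdeg
  rw [Polynomial.eq_C_of_natDegree_eq_zero (p := r) (by omega)]
  simp

/-- If the matrix `Y` has only `d` nonzero columns, then `det (X + tY)` has degree at most `d`
in `t`. -/
theorem exists_det_add_smul_polynomial {n : Type*} [Fintype n] [DecidableEq n]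
    (X Y : Matrix n n ℂ) (S : Finset n) (hY : ∀ i, ∀ j ∉ S, Y i j = 0) :
    ∃ q : Polynomial ℂ, q.natDegree ≤ S.card ∧ ∀ t, q.eval t = (X + t • Y).det := by
  let M : Matrix n n (Polynomial ℂ) := Matrix.of fun i j =>
    Polynomial.C (X i j) + Polynomial.C (Y i j) * Polynomial.X
  refine ⟨M.det, ?_, fun t => ?_⟩
  · rw [Matrix.det_apply]
    refine Polynomial.natDegree_sum_le_of_forall_le _ _ fun σ _ => ?_
    have h : (∏ i, M (σ i) i).natDegree ≤ S.card := by
      refine (Polynomial.natDegree_prod_le _ _).trans ?_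
      rw [Finset.card_eq_sum_ones, ← Finset.sum_subset (Finset.subset_univ S) (f := fun i =>
        (M (σ i) i).natDegree)]
      · refine Finset.sum_le_sum fun i _ => ?_
        simp only [M, Matrix.of_apply]
        compute_degree
      · intro i _ hi
        simp [M, hY _ i hi]
    rcases Int.units_eq_one_or (Equiv.Perm.sign σ) with hs | hs
    · rw [hs, one_smul]; exact h
    · rw [hs, Units.neg_smul, one_smul, Polynomial.natDegree_neg]; exact h
  · rw [← Polynomial.coe_evalRingHom, RingHom.map_det]
    congr 1
    ext i j
    simp only [M, RingHom.mapMatrix_apply, Matrix.map_apply, Matrix.of_apply,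
      Polynomial.coe_evalRingHom, Polynomial.eval_add,
      Polynomial.eval_mul, Polynomial.eval_C, Polynomial.eval_X, Matrix.add_apply,
      Matrix.smul_apply, smul_eq_mul]
    ring

theorem surjective_of_det_ne_zero {n M M' : Type*} [Fintype n] [DecidableEq n] [AddCommMonoid M]
    [Module ℂ M] [AddCommMonoid M'] [Module ℂ M'] (b : Basis n ℂ M) (c : Basis n ℂ M')
    (f : M →ₗ[ℂ] M') (h : (LinearMap.toMatrix b c f).det ≠ 0) : Function.Surjective f :=
  letI := Module.addCommMonoidToAddCommGroup ℂ (M := M)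
  letI := Module.addCommMonoidToAddCommGroup ℂ (M := M')
  (LinearEquiv.ofIsUnitDet (isUnit_iff_ne_zero.2 h)).surjective

theorem det_toMatrix_smul {n M M' : Type*} [Fintype n] [DecidableEq n] [AddCommMonoid M]
    [Module ℂ M] [AddCommMonoid M'] [Module ℂ M'] (b : Basis n ℂ M) (c : Basis n ℂ M') (t : ℂ)
    (f : M →ₗ[ℂ] M') : (LinearMap.toMatrix b c (t • f)).det =
      t ^ Fintype.card n * (LinearMap.toMatrix b c f).det := by
  rw [map_smul, Matrix.det_smul]

theorem det_ne_zero_of_surjective {n M M' : Type*} [Fintype n] [DecidableEq n] [AddCommMonoid M]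
    [Module ℂ M] [AddCommMonoid M'] [Module ℂ M'] (b : Basis n ℂ M) (c : Basis n ℂ M')
    (f : M →ₗ[ℂ] M') (h : Function.Surjective f) : (LinearMap.toMatrix b c f).det ≠ 0 := by
  let := Module.addCommMonoidToAddCommGroup ℂ (M := M)
  let := Module.addCommMonoidToAddCommGroup ℂ (M := M')
  have : Module.Finite ℂ M := Module.Finite.of_basis b
  have : Module.Finite ℂ M' := Module.Finite.of_basis c
  have hinj : Function.Injective f := (LinearMap.injective_iff_surjective_of_finrank_eq_finrank
    (by rw [finrank_eq_card_basis b, finrank_eq_card_basis c])).2 h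
  exact (LinearEquiv.isUnit_det (LinearEquiv.ofBijective f ⟨hinj, h⟩) b c).ne_zero

/-- Surjectivity is an open condition on a linear family of linear maps: if `g` is a right inverse
of `Λ A`, then `det (Λ B ∘ g)` is a polynomial in `B`, equal to `1` at `A`, which vanishes whenever
`Λ B` is not surjective. -/
theorem exists_eval_ne_zero_of_surjective [Fintype ι] (e : Basis ι ℂ E) {M M' : Type*}
    [AddCommGroup M] [Module ℂ M] [AddCommGroup M'] [Module ℂ M'] [Module.Finite ℂ M']
    (Λ : E →ₗ[ℂ] M →ₗ[ℂ] M') {A : E} (hA : Function.Surjective (Λ A)) :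
    ∃ Q : MvPolynomial ι ℂ, MvPolynomial.eval (e.repr A) Q ≠ 0 ∧
      ∀ B, ¬ Function.Surjective (Λ B) → MvPolynomial.eval (e.repr B) Q = 0 := by
  obtain ⟨g, hg⟩ := LinearMap.exists_rightInverse_of_surjective _ (LinearMap.range_eq_top.2 hA)
  let c := Module.finBasis ℂ M'
  obtain ⟨Q, hQ, -⟩ := exists_det_polynomial e
    ((LinearMap.toMatrix c c).toLinearMap ∘ₗ LinearMap.lcomp ℂ _ g ∘ₗ Λ)
  have hQ' : ∀ B, MvPolynomial.eval (e.repr B) Q = (LinearMap.toMatrix c c (Λ B ∘ₗ g)).det := hQ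
  refine ⟨Q, ?_, fun B hB => ?_⟩
  · rw [hQ', hg, LinearMap.toMatrix_id, Matrix.det_one]
    exact one_ne_zero
  · rw [hQ']
    by_contra h
    refine hB fun x => ?_
    obtain ⟨z, hz⟩ := surjective_of_det_ne_zero c c _ h x
    exact ⟨g z, hz⟩

end Polynomials

/-! ### Irreducibility of the set of degenerate matrices -/

section Irreducible

variable {p : ℕ} {V₀ : Type*} {V : Fin p → Type*}
  [AddCommGroup V₀] [Module ℂ V₀] [∀ i, AddCommGroup (V i)] [∀ i, Module ℂ (V i)]

theorem map_add_smul_mem_polyCurves {κ F : Type*} [Fintype κ] {M : κ → Type*}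
    [∀ i, AddCommGroup (M i)] [∀ i, Module ℂ (M i)] [AddCommGroup F] [Module ℂ F]
    (Φ : MultilinearMap ℂ M F) (a b : ∀ i, M i) :
    (fun t : ℂ => Φ (a + t • b)) ∈ polyCurves F := by
  classical
  have h : ∀ t : ℂ, Φ (a + t • b) = ∑ s : Finset κ, t ^ (sᶜ.card) • Φ (s.piecewise a b) := by
    intro t
    rw [Φ.map_add_univ]
    refine Finset.sum_congr rfl fun s _ => ?_
    have : s.piecewise a (t • b) = fun i => (s.piecewise (1 : κ → ℂ) fun _ => t) i •
        s.piecewise a b i := by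
      ext i
      by_cases hi : i ∈ s <;> simp [hi]
    rw [this, Φ.map_smul_univ]
    congr 1
    rw [Finset.prod_piecewise]
    simp [Finset.compl_eq_univ_sdiff]
  have h' : (fun t : ℂ => Φ (a + t • b)) =
      ∑ s : Finset κ, fun t : ℂ => t ^ (sᶜ.card) • Φ (s.piecewise a b) := by
    ext t
    rw [h t, Finset.sum_apply]
  rw [h']
  exact (polyCurves F).sum_mem fun s _ => pow_smul_mem_polyCurves _ _

/-- After rescaling, two nonzero linear forms take the value `1` at a common vector. -/
theorem exists_smul_apply_eq_one {W : Type*} [AddCommGroup W] [Module ℂ W] {v w : Dual ℂ W}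
    (hv : v ≠ 0) (hw : w ≠ 0) : ∃ (a b : ℂ) (y : W), (a • v) y = 1 ∧ (b • w) y = 1 := by
  obtain ⟨y, hy⟩ : ∃ y, v y ≠ 0 ∧ w y ≠ 0 := by
    obtain ⟨x, hx⟩ := exists_apply_eq_one hv
    obtain ⟨z, hz⟩ := exists_apply_eq_one hw
    by_cases h1 : w x = 0
    · by_cases h2 : v z = 0
      · exact ⟨x + z, by simp [hx, h2], by simp [hz, h1]⟩
      · exact ⟨z, h2, by simp [hz]⟩
    · exact ⟨x, by simp [hx], h1⟩
  exact ⟨(v y)⁻¹, (w y)⁻¹, y, by simp [hy.1], by simp [hy.2]⟩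

theorem contract_smul (c : Fin p → ℂ) (v : ∀ i, Dual ℂ (V i)) (A : MultiMatrix V₀ V) :
    contract (fun i => c i • v i) A = (∏ i, c i) • contract v A := by
  rw [← toDualMap_tprod, ← toDualMap_tprod, MultilinearMap.map_smul_univ, map_smul]

/-- Any two degenerate matrices lie on a polynomial curve of degenerate matrices: if they are
degenerate at `v` and `w`, normalized such that `v_i(y_i) = w_i(y_i) = 1`, then the segment between
them can be corrected by multiples of `y₁ ⊗ ⋯ ⊗ y_p` to be degenerate at `(1 - t) v + t w`. -/
theorem exists_curve_of_isDegenerate {A B : MultiMatrix V₀ V} (hA : IsDegenerate A)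
    (hB : IsDegenerate B) :
    ∃ γ ∈ polyCurves (MultiMatrix V₀ V), (∀ t, IsDegenerate (γ t)) ∧ γ 0 = A ∧ γ 1 = B := by
  obtain ⟨v, hv, hAv⟩ := hA
  obtain ⟨w, hw, hBw⟩ := hB
  rw [toDualMap_tprod] at hAv hBw
  choose a b y hvy hwy using fun i => exists_smul_apply_eq_one (hv i) (hw i)
  let v' : ∀ i, Dual ℂ (V i) := fun i => a i • v i
  let u : ∀ i, Dual ℂ (V i) := fun i => b i • w i - a i • v i
  have huy : ∀ (t : ℂ) i, (v' + t • u) i (y i) = 1 := fun t i => by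
    have : u i (y i) = 0 := by simp only [u, LinearMap.sub_apply, hvy, hwy, sub_self]
    change (a i • v i) (y i) + t • (u i (y i)) = 1
    rw [this, hvy, smul_zero, add_zero]
  let Y : V₀ →ₗ[ℂ] MultiMatrix V₀ V :=
    (TensorProduct.mk ℂ V₀ (⨂[ℂ] i, V i)).flip (PiTensorProduct.tprod ℂ y)
  have hY : ∀ (t : ℂ) x, contract (v' + t • u) (Y x) = x := fun t x => by
    change contract (v' + t • u) (x ⊗ₜ[ℂ] PiTensorProduct.tprod ℂ y) = x
    rw [contract_tmul, PiTensorProduct.dualDistrib_apply]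
    simp only [huy, Finset.prod_const_one, one_smul]
  have hA' : contract v' A = 0 := by rw [contract_smul, hAv, smul_zero]
  have hB' : contract (v' + (1 : ℂ) • u) B = 0 := by
    have : v' + (1 : ℂ) • u = fun i => b i • w i := by ext i; simp [v', u]
    rw [this, contract_smul, hBw, smul_zero]
  let β : ℂ → MultiMatrix V₀ V := fun t => A + t • (B - A)
  have hc : ∀ C : MultiMatrix V₀ V, (fun t => contract (v' + t • u) C) ∈ polyCurves V₀ := fun C =>
    map_add_smul_mem_polyCurves ((toDualMap C).compMultilinearMap (PiTensorProduct.tprod ℂ)) v' u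
  refine ⟨fun t => β t - Y (contract (v' + t • u) (β t)), ?_, fun t => ?_, ?_, ?_⟩
  · have hβ : β ∈ polyCurves (MultiMatrix V₀ V) := add_smul_mem_polyCurves A (B - A)
    have hYc : (fun t => Y (contract (v' + t • u) (β t))) ∈ polyCurves (MultiMatrix V₀ V) := by
      refine map_mem_polyCurves Y ?_
      have : (fun t => contract (v' + t • u) (β t)) = (fun t => contract (v' + t • u) A) +
          fun t => t ^ 1 • contract (v' + t • u) (B - A) := by
        ext t
        simp only [β, map_add, map_smul, Pi.add_apply, pow_one]
      rw [this]
      exact (polyCurves _).add_mem (hc A) (pow_smul_mem_polyCurves_of_mem (hc _) 1)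
    exact sub_mem_polyCurves hβ hYc
  · refine ⟨v' + t • u, fun i h0 => ?_, ?_⟩
    · have := huy t i
      rw [h0] at this
      simp at this
    · rw [toDualMap_tprod, map_sub, hY, sub_self]
  · simp [β, hA']
  · simp only [β, one_smul, add_sub_cancel]
    rw [← one_smul ℂ u, hB', map_zero, sub_zero]

/-- The polynomials vanishing on the degenerate matrices form a prime ideal. -/
theorem forall_eval_eq_zero_of_mul {ι : Type*} (e : Basis ι ℂ (MultiMatrix V₀ V))
    {f g : MvPolynomial ι ℂ} (hfg : ∀ A : MultiMatrix V₀ V, IsDegenerate A →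
      MvPolynomial.eval (e.repr A) f = 0 ∨ MvPolynomial.eval (e.repr A) g = 0) :
    (∀ A : MultiMatrix V₀ V, IsDegenerate A → MvPolynomial.eval (e.repr A) f = 0) ∨
      ∀ A : MultiMatrix V₀ V, IsDegenerate A → MvPolynomial.eval (e.repr A) g = 0 := by
  by_contra! h
  obtain ⟨⟨A, hA, hfA⟩, B, hB, hgB⟩ := h
  obtain ⟨γ, hγ, hdeg, h0, h1⟩ := exists_curve_of_isDegenerate hA hB
  obtain ⟨φ, hφ⟩ := exists_eval_curve e hγ
  have hz : φ f * φ g = 0 := Polynomial.funext fun t => by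
    rcases hfg _ (hdeg t) with h | h <;> simp [hφ, h]
  rcases mul_eq_zero.1 hz with h | h
  · exact hfA (by rw [← h0, ← hφ, h, Polynomial.eval_zero])
  · exact hgB (by rw [← h1, ← hφ, h, Polynomial.eval_zero])

end Irreducible

/-! ### Elimination of a variable -/

section Elimination

/-- If an irreducible polynomial `D` of positive degree over a factorial ring does not divide `G`,
then by Gauss's lemma `D` and `G` are coprime over the field of fractions, so that the ideal they
generate contains a nonzero constant. -/
theorem exists_C_mem_span_pair {B : Type*} [CommRing B] [IsDomain B] [UniqueFactorizationMonoid B]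
    {D G : Polynomial B} (hD : Irreducible D) (hdeg : D.natDegree ≠ 0) (hDG : ¬ D ∣ G) :
    ∃ b : B, b ≠ 0 ∧ Polynomial.C b ∈ Ideal.span {D, G} := by
  let K := FractionRing B
  have hinj : Function.Injective (algebraMap B K) := IsFractionRing.injective B K
  have hprim := hD.isPrimitive hdeg
  have hDK : Irreducible (D.map (algebraMap B K)) :=
    (hprim.irreducible_iff_irreducible_map_fraction_map (K := K)).1 hD
  have hcop : IsCoprime (D.map (algebraMap B K)) (G.map (algebraMap B K)) :=
    hDK.coprime_iff_not_dvd.2 fun h => hDG (hprim.dvd_of_fraction_map_dvd_fraction_map (K := K) h)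
  obtain ⟨u, v, huv⟩ := hcop
  obtain ⟨a, ha0, ha⟩ := IsLocalization.integerNormalization_spec (nonZeroDivisors B) u
  obtain ⟨c, hc0, hc⟩ := IsLocalization.integerNormalization_spec (nonZeroDivisors B) v
  refine ⟨a * c, mul_ne_zero (nonZeroDivisors.ne_zero ha0) (nonZeroDivisors.ne_zero hc0),
    Ideal.mem_span_pair.2
      ⟨Polynomial.C c * IsLocalization.integerNormalization (nonZeroDivisors B) u,
        Polynomial.C a * IsLocalization.integerNormalization (nonZeroDivisors B) v, ?_⟩⟩
  apply Polynomial.map_injective _ hinj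
  simp only [Polynomial.map_add, Polynomial.map_mul, ha, hc, Polynomial.map_C, map_mul,
    Algebra.smul_def, Polynomial.algebraMap_apply]
  linear_combination Polynomial.C (algebraMap B K a) * Polynomial.C (algebraMap B K c) * huv

/-- If `D` is irreducible, does not divide `G` and involves the variable `i₀`, then this variable
can be eliminated: the ideal generated by `D` and `G` contains a nonzero polynomial whose values
do not depend on the coordinate `i₀`. -/
theorem exists_mem_span_pair_eval_eq {ι : Type*} {D G : MvPolynomial ι ℂ} (hD : Irreducible D)
    {i₀ : ι} (hi₀ : i₀ ∈ D.vars) (hDG : ¬ D ∣ G) :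
    ∃ R ∈ Ideal.span {D, G}, R ≠ 0 ∧ ∀ x y : ι → ℂ, (∀ i ≠ i₀, x i = y i) →
      MvPolynomial.eval x R = MvPolynomial.eval y R := by
  classical
  let σ : ι ≃ Option {i // i ≠ i₀} := (Equiv.optionSubtypeNe i₀).symm
  let Φ : MvPolynomial ι ℂ ≃ₐ[ℂ] Polynomial (MvPolynomial {i // i ≠ i₀} ℂ) :=
    (MvPolynomial.renameEquiv ℂ σ).trans (MvPolynomial.optionEquivLeft ℂ _)
  have hdeg : (Φ D).natDegree ≠ 0 := by
    change (MvPolynomial.optionEquivLeft ℂ _ (MvPolynomial.rename σ D)).natDegree ≠ 0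
    rw [MvPolynomial.natDegree_optionEquivLeft,
      show none = σ i₀ from (Equiv.optionSubtypeNe_symm_self i₀).symm,
      MvPolynomial.degreeOf_rename_of_injective σ.injective]
    exact MvPolynomial.mem_vars_iff_degreeOf_ne_zero.1 hi₀
  obtain ⟨b, hb, hmem⟩ := exists_C_mem_span_pair ((MulEquiv.irreducible_iff Φ).2 hD) hdeg
    (G := Φ G) (fun h => hDG ((map_dvd_iff Φ).1 h))
  have hR : Φ (MvPolynomial.rename Subtype.val b) = Polynomial.C b := by
    have h : Φ.toAlgHom.comp (MvPolynomial.rename Subtype.val) =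
        (Polynomial.CAlgHom : MvPolynomial {i // i ≠ i₀} ℂ →ₐ[MvPolynomial {i // i ≠ i₀} ℂ]
          _).restrictScalars ℂ := by
      apply MvPolynomial.algHom_ext
      intro i
      have : σ i = some i := Equiv.optionSubtypeNe_symm_of_ne i.2
      simp [Φ, this, MvPolynomial.optionEquivLeft_X_some]
    exact congrArg (fun f => f b) h
  refine ⟨MvPolynomial.rename Subtype.val b, ?_, ?_, fun x y hxy => ?_⟩
  · obtain ⟨u, v, huv⟩ := Ideal.mem_span_pair.1 hmem
    refine Ideal.mem_span_pair.2 ⟨Φ.symm u, Φ.symm v, Φ.injective ?_⟩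
    rw [hR, ← huv, map_add, map_mul, map_mul, Φ.apply_symm_apply, Φ.apply_symm_apply]
  · exact fun h => hb (MvPolynomial.rename_injective _ Subtype.val_injective (by rw [h, map_zero]))
  · rw [MvPolynomial.eval_rename, MvPolynomial.eval_rename]
    congr 2
    ext i
    exact hxy i i.2

end Elimination

/-! ### Dominance of the projections of the set of degenerate matrices -/

section Dominance

variable {p : ℕ} {V₀ : Type*} {V : Fin p → Type*}
  [AddCommGroup V₀] [Module ℂ V₀] [∀ i, AddCommGroup (V i)] [∀ i, Module ℂ (V i)]

/-- A nonzero matrix has a nonzero slice. -/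
theorem exists_contract_coord_ne_zero {κ₀ : Type*} {κ : Fin p → Type*} [∀ i, Finite (κ i)]
    (b : Basis κ₀ ℂ V₀) (β : ∀ i, Basis (κ i) ℂ (V i)) {w : MultiMatrix V₀ V} (hw : w ≠ 0) :
    ∃ J : ∀ i, κ i, contract (fun i => (β i).coord (J i)) w ≠ 0 := by
  classical
  by_contra! h
  let c := b.tensorProduct (Basis.piTensorProduct β)
  refine hw (c.ext_elem fun ⟨j, J⟩ => ?_)
  have : c.coord (j, J) = b.coord j ∘ₗ contract fun i => (β i).coord (J i) := by
    refine TensorProduct.ext' fun x t => ?_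
    rw [LinearMap.comp_apply, contract_tmul, map_smul, Basis.coord_apply,
      Basis.tensorProduct_repr_tmul_apply, Basis.coord_apply, smul_eq_mul, smul_eq_mul]
    congr 1
    have : (Basis.piTensorProduct β).coord J =
        PiTensorProduct.dualDistrib (PiTensorProduct.tprod ℂ fun i => (β i).coord (J i)) := by
      refine PiTensorProduct.ext (MultilinearMap.ext fun y => ?_)
      simp [PiTensorProduct.dualDistrib_apply, Basis.piTensorProduct_repr_tprod_apply]
    rw [← this, Basis.coord_apply]
  have h1 := congrArg (fun f => f w) this
  simpa [h] using h1

/-- A nonzero vector can be completed to a generating system by `finrank - 1` vectors. -/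
theorem exists_forall_eq_top {κ : Type*} [Fintype κ] {x : V₀} (hx : x ≠ 0)
    (h : finrank ℂ V₀ = Fintype.card κ + 1) :
    ∃ g : κ → V₀, ∀ N : Submodule ℂ V₀, x ∈ N → (∀ i, g i ∈ N) → N = ⊤ := by
  have : Module.Finite ℂ V₀ := Module.finite_of_finrank_pos (by omega)
  let X : Submodule ℂ V₀ := Submodule.span ℂ {x}
  have hq : finrank ℂ (V₀ ⧸ X) = Fintype.card κ := by
    have h1 := X.finrank_quotient_add_finrank
    rw [finrank_span_singleton hx, h] at h1
    omega
  let β := (Module.finBasisOfFinrankEq ℂ (V₀ ⧸ X) hq).reindex (Fintype.equivFin κ).symm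
  choose g hg using fun i => X.mkQ_surjective (β i)
  refine ⟨g, fun N hx hN => ?_⟩
  have hX : X ≤ N := by simpa [X] using hx
  have hmap : N.map X.mkQ = ⊤ := by
    rw [eq_top_iff, ← β.span_eq, Submodule.span_le]
    rintro _ ⟨i, rfl⟩
    exact ⟨g i, hN i, hg i⟩
  have := congrArg (Submodule.comap X.mkQ) hmap
  rwa [Submodule.comap_map_mkQ, Submodule.comap_top, sup_eq_right.2 hX] at this

theorem contDiff_apply_contract {κ : Fin p → Type*} [∀ i, Fintype (κ i)]
    (β : ∀ i, Basis (κ i) ℂ (V i)) (C : MultiMatrix V₀ V) (f : Dual ℂ V₀) :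
    ContDiff ℂ 1 fun x : (∀ i, κ i → ℂ) =>
      f (contract (fun i => ∑ b, x i b • (β i).coord b) C) := by
  simp only [apply_contract]
  induction toMap C f using PiTensorProduct.induction_on with
  | smul_tprod c y =>
    simp only [map_smul, PiTensorProduct.dualDistrib_apply, LinearMap.sum_apply,
      LinearMap.smul_apply, smul_eq_mul]
    exact contDiff_const.mul (contDiff_prod fun i _ => ContDiff.sum fun b _ =>
      (contDiff_pi.1 (contDiff_pi.1 contDiff_id i) b).mul contDiff_const)
  | add s t hs ht => simpa only [map_add] using hs.add ht

/-- A polynomial vanishing on the degenerate matrices and invariant under translations in a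
direction `w ≠ 0` is zero. Indeed the matrices `∏ v_i(y_i) • B - B(v) ⊗ y₁ ⊗ ⋯ ⊗ y_p + s • w`,
where the first two terms form a matrix degenerate at `v`, fill an open set, since the derivative
of this expression with respect to `(v, B, s)` is surjective at a suitable point: variation of `B`
yields everything up to `V₀ ⊗ y₁ ⊗ ⋯ ⊗ y_p`, and there are `k₁ + ⋯ + k_p = dim V₀ - 1` variations
of `v`, which together with that of `s` yield the rest. -/
theorem eq_zero_of_forall_isDegenerate {k₀ : ℕ} {k : Fin p → ℕ} (hk : k₀ = ∑ i, k i)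
    (hV₀ : finrank ℂ V₀ = k₀ + 1) (hV : ∀ i, finrank ℂ (V i) = k i + 1)
    {ι : Type*} [Fintype ι] (e : Basis ι ℂ (MultiMatrix V₀ V)) {w : MultiMatrix V₀ V} (hw : w ≠ 0)
    {R : MvPolynomial ι ℂ}
    (hR : ∀ A : MultiMatrix V₀ V, IsDegenerate A → MvPolynomial.eval (e.repr A) R = 0)
    (hinv : ∀ (A : MultiMatrix V₀ V) (s : ℂ),
      MvPolynomial.eval (e.repr (A + s • w)) R = MvPolynomial.eval (e.repr A) R) :
    R = 0 := by
  classical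
  have hfin : ∀ i, Module.Finite ℂ (V i) := fun i =>
    Module.finite_of_finrank_pos (by rw [hV i]; omega)
  have hfin₀ : Module.Finite ℂ V₀ := Module.finite_of_finrank_pos (by omega)
  let β : ∀ i, Basis (Fin (k i + 1)) ℂ (V i) := fun i => Module.finBasisOfFinrankEq ℂ (V i) (hV i)
  obtain ⟨a, ha⟩ := exists_contract_coord_ne_zero (Module.finBasis ℂ V₀) β hw
  let y : ∀ i, V i := fun i => β i (a i)
  let v₀ : ∀ i, Dual ℂ (V i) := fun i => (β i).coord (a i)
  have hv₀y : ∀ i, v₀ i (y i) = 1 := fun i => by simp [v₀, y]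
  let κ := Σ i, {c : Fin (k i + 1) // c ≠ a i}
  have hκ : finrank ℂ V₀ = Fintype.card κ + 1 := by
    simp [κ, Fintype.card_sigma, hV₀, hk]
  obtain ⟨g, hg⟩ := exists_forall_eq_top ha hκ
  let Y : V₀ →ₗ[ℂ] MultiMatrix V₀ V :=
    (TensorProduct.mk ℂ V₀ (⨂[ℂ] i, V i)).flip (PiTensorProduct.tprod ℂ y)
  have hY : ∀ (v : ∀ i, Dual ℂ (V i)) x, contract v (Y x) = (∏ i, v i (y i)) • x := fun v x => by
    change contract v (x ⊗ₜ[ℂ] PiTensorProduct.tprod ℂ y) = _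
    rw [contract_tmul, PiTensorProduct.dualDistrib_apply]
  -- at `B₀`, the variation of `v` in the direction indexed by `q` changes `B₀(v)` by `g q`
  let B₀ : MultiMatrix V₀ V := ∑ q : κ, g q ⊗ₜ[ℂ]
    PiTensorProduct.tprod ℂ (Function.update y q.1 (β q.1 q.2.1))
  have hB₀ : ∀ q : κ, contract (Function.update v₀ q.1 ((β q.1).coord q.2.1)) B₀ = g q := by
    rintro ⟨i, c, hc⟩
    simp only [B₀, map_sum, contract_tmul, PiTensorProduct.dualDistrib_apply]
    rw [Finset.sum_eq_single ⟨i, c, hc⟩]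
    · rw [Finset.prod_eq_one, one_smul]
      intro l _
      rcases eq_or_ne l i with rfl | hl
      · simp
      · simp [Function.update_of_ne hl, hv₀y]
    · rintro ⟨i', c', hc'⟩ _ hne
      rw [Finset.prod_eq_zero (Finset.mem_univ i), zero_smul]
      rcases eq_or_ne i i' with rfl | hi
      · have : c' ≠ c := fun h => hne (by subst h; rfl)
        simp [this]
      · simp [Function.update_of_ne hi, y, hc.symm]
    · simp
  let vv : (∀ i, Fin (k i + 1) → ℂ) → ∀ i, Dual ℂ (V i) := fun x i =>
    ∑ c, x i c • (β i).coord c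
  have hvvy : ∀ x i, vv x i (y i) = x i (a i) := fun x i => by
    simp [vv, y, Finsupp.single_apply]
  let Ψ' : (∀ i, Dual ℂ (V i)) → MultiMatrix V₀ V → ℂ → MultiMatrix V₀ V := fun v B s =>
    (∏ i, v i (y i)) • B - Y (contract v B) + s • w
  let Ψ : (∀ i, Fin (k i + 1) → ℂ) × (ι → ℂ) × ℂ → (ι → ℂ) := fun z =>
    e.equivFun (Ψ' (vv z.1) (e.equivFun.symm z.2.1) z.2.2)
  have hΨ : ContDiff ℂ 1 Ψ := by
    rw [contDiff_pi]
    intro j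
    have h : (fun z => Ψ z j) = fun z => (∏ i, z.1 i (a i)) * z.2.1 j -
        (∑ l, z.2.1 l * (e.coord j ∘ₗ Y) (contract (vv z.1) (e l))) + z.2.2 * e.coord j w := by
      ext z
      have hB : e.equivFun.symm z.2.1 = ∑ l, z.2.1 l • e l := e.equivFun_symm_apply _
      have hj : e.coord j (e.equivFun.symm z.2.1) = z.2.1 j := by
        rw [Basis.coord_apply, ← e.equivFun_apply, LinearEquiv.apply_symm_apply]
      change e.coord j (Ψ' (vv z.1) (e.equivFun.symm z.2.1) z.2.2) = _
      simp only [Ψ', hvvy]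
      rw [map_add, map_sub, map_smul, map_smul, hj, hB, map_sum, map_sum, map_sum]
      simp only [map_smul, smul_eq_mul, LinearMap.comp_apply]
    rw [h]
    have h1 : ∀ l, ContDiff ℂ 1 fun z : (∀ i, Fin (k i + 1) → ℂ) × (ι → ℂ) × ℂ =>
        (e.coord j ∘ₗ Y) (contract (vv z.1) (e l)) := fun l =>
      (contDiff_apply_contract β (e l) (e.coord j ∘ₗ Y)).comp contDiff_fst
    have h2 : ∀ i c, ContDiff ℂ 1 fun z : (∀ i, Fin (k i + 1) → ℂ) × (ι → ℂ) × ℂ => z.1 i c :=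
      fun i c => contDiff_pi.1 (contDiff_pi.1 contDiff_fst i) c
    have h3 : ∀ l, ContDiff ℂ 1 fun z : (∀ i, Fin (k i + 1) → ℂ) × (ι → ℂ) × ℂ => z.2.1 l :=
      fun l => contDiff_pi.1 (contDiff_fst.comp contDiff_snd) l
    exact (((contDiff_prod fun i _ => h2 i _).mul (h3 j)).sub
      (ContDiff.sum fun l _ => (h3 l).mul (h1 l))).add
        ((contDiff_snd.comp contDiff_snd).mul contDiff_const)
  let x₀ : ∀ i, Fin (k i + 1) → ℂ := fun i => Pi.single (a i) 1
  have hvx₀ : vv x₀ = v₀ := by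
    ext i : 1
    simp [vv, x₀, v₀]
  let z₀ : (∀ i, Fin (k i + 1) → ℂ) × (ι → ℂ) × ℂ := (x₀, e.equivFun B₀, 0)
  have hΨz₀ : Ψ z₀ = e.equivFun (Ψ' v₀ B₀ 0) := by
    change e.equivFun (Ψ' (vv x₀) (e.equivFun.symm (e.equivFun B₀)) 0) = _
    rw [hvx₀, LinearEquiv.symm_apply_apply]
  have hst : HasStrictFDerivAt Ψ (fderiv ℂ Ψ z₀) z₀ :=
    hΨ.contDiffAt.hasStrictFDerivAt (by norm_num)
  let S : Submodule ℂ (MultiMatrix V₀ V) :=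
    (LinearMap.range (fderiv ℂ Ψ z₀).toLinearMap).comap e.equivFun.toLinearMap
  have hS : ∀ z C, (∀ t : ℂ, Ψ (z₀ + t • z) = Ψ z₀ + t • e.equivFun C) → C ∈ S := by
    intro z C h
    refine ⟨z, ?_⟩
    have h1 : HasDerivAt (fun t : ℂ => Ψ (z₀ + t • z)) (fderiv ℂ Ψ z₀ z) 0 := by
      have hl : HasDerivAt (fun t : ℂ => z₀ + t • z) z 0 := by
        simpa using ((hasDerivAt_id (0 : ℂ)).smul_const z).const_add z₀
      refine HasFDerivAt.comp_hasDerivAt (l := Ψ) (0 : ℂ) ?_ hl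
      simpa using hst.hasFDerivAt
    have h2 : HasDerivAt (fun t : ℂ => Ψ (z₀ + t • z)) (e.equivFun C) 0 := by
      simp only [h]
      simpa using ((hasDerivAt_id (0 : ℂ)).smul_const (e.equivFun C)).const_add (Ψ z₀)
    exact h1.unique h2
  have hSC : ∀ C, C - Y (contract v₀ C) ∈ S := by
    intro C
    refine hS (0, e.equivFun C, 0) _ fun t => ?_
    rw [hΨz₀, show Ψ (z₀ + t • (0, e.equivFun C, 0)) = e.equivFun (Ψ' (vv (x₀ + t • 0))
      (e.equivFun.symm (e.equivFun B₀ + t • e.equivFun C)) (0 + t • 0)) from rfl,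
      smul_zero, smul_zero, add_zero, add_zero, hvx₀, ← map_smul, ← map_add, ← map_smul, ← map_add,
      LinearEquiv.symm_apply_apply]
    congr 1
    simp only [Ψ', hv₀y, Finset.prod_const_one, map_add, map_smul]
    module
  have hSw : w ∈ S := by
    refine hS (0, 0, 1) _ fun t => ?_
    rw [hΨz₀, show Ψ (z₀ + t • (0, 0, 1)) = e.equivFun (Ψ' (vv (x₀ + t • 0))
      (e.equivFun.symm (e.equivFun B₀ + t • 0)) (0 + t • 1)) from rfl,
      smul_zero, smul_zero, add_zero, add_zero, hvx₀, LinearEquiv.symm_apply_apply, ← map_smul,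
      ← map_add]
    congr 1
    simp only [Ψ', zero_smul, add_zero, zero_add, smul_eq_mul, mul_one]
  have hSg : ∀ q, Y (g q) ∈ S := by
    rintro ⟨i, c, hc⟩
    rw [← neg_mem_iff]
    let δ : ∀ i, Fin (k i + 1) → ℂ := Pi.single i (Pi.single c 1)
    refine hS (δ, 0, 0) _ fun t => ?_
    have hvt : vv (x₀ + t • δ) =
        Function.update v₀ i (v₀ i + t • (β i).coord c) := by
      ext l : 1
      rcases eq_or_ne l i with rfl | hl
      · rw [Function.update_self, ← hvx₀]
        simp [vv, δ, add_smul, Finset.sum_add_distrib, Pi.single_apply]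
      · rw [Function.update_of_ne hl, ← hvx₀]
        simp [vv, δ, hl]
    have hprod : ∏ l, (Function.update v₀ i (v₀ i + t • (β i).coord c)) l (y l) = 1 := by
      refine Finset.prod_eq_one fun l _ => ?_
      rcases eq_or_ne l i with rfl | hl
      · simp [hv₀y, y, hc.symm]
      · simp [Function.update_of_ne hl, hv₀y]
    have hcontr : contract (Function.update v₀ i (v₀ i + t • (β i).coord c)) B₀ =
        contract v₀ B₀ + t • g ⟨i, c, hc⟩ := by
      rw [← hB₀ ⟨i, c, hc⟩]
      simp only [← toDualMap_tprod]
      rw [MultilinearMap.map_update_add, MultilinearMap.map_update_smul, Function.update_eq_self,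
        map_add, map_smul]
    rw [hΨz₀, show Ψ (z₀ + t • (δ, 0, 0)) = e.equivFun
      (Ψ' (vv (x₀ + t • δ))
      (e.equivFun.symm (e.equivFun B₀ + t • 0)) (0 + t • 0)) from rfl,
      smul_zero, smul_zero, add_zero, add_zero, hvt, LinearEquiv.symm_apply_apply, ← map_smul,
      ← map_add]
    congr 1
    simp only [Ψ', hprod, hv₀y, Finset.prod_const_one, hcontr, map_add, map_smul]
    module
  have hSY : S.comap Y = ⊤ := by
    refine hg _ ?_ hSg
    have h := S.sub_mem hSw (hSC w)
    rwa [sub_sub_cancel] at h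
  have hStop : ∀ C, C ∈ S := fun C => by
    have h1 : Y (contract v₀ C) ∈ S := by
      change contract v₀ C ∈ S.comap Y
      rw [hSY]; trivial
    have := S.add_mem (hSC C) h1
    rwa [sub_add_cancel] at this
  have hsurj : (fderiv ℂ Ψ z₀).range = ⊤ := by
    rw [LinearMap.range_eq_top]
    intro x
    obtain ⟨z, hz⟩ := hStop (e.equivFun.symm x)
    exact ⟨z, hz.trans (e.equivFun.apply_symm_apply x)⟩
  have hopen := hst.map_nhds_eq_of_surj hsurj
  have hU : {z : (∀ i, Fin (k i + 1) → ℂ) × (ι → ℂ) × ℂ | ∀ i, z.1 i (a i) ≠ 0} ∈ nhds z₀ := by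
    refine IsOpen.mem_nhds ?_ (by simp [z₀, x₀])
    simp only [Set.ofPred_forall]
    exact isOpen_iInter_of_finite fun i => isOpen_ne_fun (by fun_prop) continuous_const
  have himg := Filter.image_mem_map (m := Ψ) hU
  rw [hopen] at himg
  obtain ⟨ε, hε, hball⟩ := Metric.mem_nhds_iff.1 himg
  refine MvPolynomial.funext_set (fun i => Metric.ball (Ψ z₀ i) ε)
    (fun i => infinite_of_mem_nhds _ (Metric.ball_mem_nhds _ hε)) fun x hx => ?_
  rw [← ball_pi _ hε] at hx
  obtain ⟨z, hz, rfl⟩ := hball hx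
  rw [map_zero]
  change MvPolynomial.eval (e.repr (Ψ' (vv z.1) (e.equivFun.symm z.2.1) z.2.2)) R = 0
  rw [hinv]
  refine hR _ ⟨vv z.1, fun i h0 => hz i ?_, ?_⟩
  · rw [← hvvy z.1 i, h0, LinearMap.zero_apply]
  · rw [toDualMap_tprod, map_sub, hY, map_smul, sub_self]

end Dominance

/-! ### Surjectivity in high degrees for nondegenerate matrices -/

section Nullstellensatz

variable {p : ℕ} {V₀ : Type*} {V : Fin p → Type*}
  [AddCommGroup V₀] [Module ℂ V₀] [∀ i, AddCommGroup (V i)] [∀ i, Module ℂ (V i)]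

theorem prod_ι_pow_mem_symPow {W κ : Type*} [AddCommGroup W] [Module ℂ W] (β : κ → W)
    (s : Finset κ) (d : κ → ℕ) :
    ∏ a ∈ s, SymmetricAlgebra.ι ℂ W (β a) ^ d a ∈ symPow W (∑ a ∈ s, d a) := by
  classical
  induction s using Finset.induction_on with
  | empty => simp [symPow, Submodule.one_eq_range]
  | insert a s ha ih =>
    rw [Finset.prod_insert ha, Finset.sum_insert ha, symPow, pow_add]
    exact Submodule.mul_mem_mul
      (Submodule.pow_mem_pow (LinearMap.range _) (LinearMap.mem_range_self _ _) _) ih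

theorem symPow_le_span_monomials {W κ : Type*} [AddCommGroup W] [Module ℂ W] [Fintype κ]
    (β : Basis κ ℂ W) (n : ℕ) :
    symPow W n ≤ Submodule.span ℂ {x | ∃ d : κ → ℕ, ∑ a, d a = n ∧
      x = ∏ a, SymmetricAlgebra.ι ℂ W (β a) ^ d a} := by
  classical
  induction n with
  | zero =>
    rw [symPow, pow_zero, Submodule.one_eq_span]
    refine Submodule.span_mono ?_
    rintro _ rfl
    exact ⟨0, by simp, by simp⟩
  | succ n ih =>
    have hr : LinearMap.range (SymmetricAlgebra.ι ℂ W) =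
        Submodule.span ℂ (Set.range fun a => SymmetricAlgebra.ι ℂ W (β a)) := by
      rw [LinearMap.range_eq_map, ← β.span_eq, Submodule.map_span, ← Set.range_comp]
      rfl
    rw [symPow, pow_succ']
    refine (mul_le_mul' hr.le ih).trans ?_
    rw [Submodule.span_mul_span]
    refine Submodule.span_mono ?_
    rintro _ ⟨_, ⟨a, rfl⟩, _, ⟨d, hd, rfl⟩, rfl⟩
    refine ⟨d + Pi.single a 1, by simp [Finset.sum_add_distrib, hd], ?_⟩
    have h : ∏ b, SymmetricAlgebra.ι ℂ W (β b) ^ (Pi.single a 1 : κ → ℕ) b =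
        SymmetricAlgebra.ι ℂ W (β a) := by
      rw [Finset.prod_eq_single a (fun b _ hb => by simp [hb]) (by simp)]
      simp
    simp only [Pi.add_apply, pow_add, Finset.prod_mul_distrib, h]
    exact mul_comm _ _

variable {κ : Fin p → Type*} (β : ∀ i, Basis (κ i) ℂ (V i))

/-- A tensor in `V₁ ⊗ ⋯ ⊗ V_p` as a multilinear form in the coordinates on the `V_i^∨`. -/
def tensorForm : (⨂[ℂ] i, V i) →ₗ[ℂ] MvPolynomial (Σ i, κ i) ℂ :=
  (Basis.piTensorProduct β).constr ℂ fun J => ∏ i, MvPolynomial.X ⟨i, J i⟩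

theorem tensorForm_tprod (J : ∀ i, κ i) :
    tensorForm β (PiTensorProduct.tprod ℂ fun i => β i (J i)) =
      ∏ i, MvPolynomial.X ⟨i, J i⟩ := by
  rw [← Basis.piTensorProduct_apply, tensorForm, Basis.constr_basis]

variable [∀ i, Fintype (κ i)]

theorem eval_tensorForm (x : (Σ i, κ i) → ℂ) (t : ⨂[ℂ] i, V i) :
    MvPolynomial.eval x (tensorForm β t) = PiTensorProduct.dualDistrib
      (PiTensorProduct.tprod ℂ fun i => ∑ c, x ⟨i, c⟩ • (β i).coord c) t := by
  classical
  have h : (MvPolynomial.aeval x).toLinearMap ∘ₗ tensorForm β = PiTensorProduct.dualDistrib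
      (PiTensorProduct.tprod ℂ fun i => ∑ c, x ⟨i, c⟩ • (β i).coord c) := by
    refine (Basis.piTensorProduct β).ext fun J => ?_
    rw [LinearMap.comp_apply, Basis.piTensorProduct_apply, tensorForm_tprod,
      PiTensorProduct.dualDistrib_apply]
    simp [Finsupp.single_apply]
  exact congrArg (fun f => f t) h

/-- The component of multidegree `r` of a polynomial in the coordinates on the `V_i^∨`, as an
element of `S^{r₁}V₁ ⊗ ⋯ ⊗ S^{r_p}V_p`. -/
def component (r : Fin p → ℕ) : MvPolynomial (Σ i, κ i) ℂ →ₗ[ℂ] ⨂[ℂ] i, symPow (V i) (r i) :=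
  open Classical in
  (MvPolynomial.basisMonomials (Σ i, κ i) ℂ).constr ℂ fun m =>
    if h : ∀ i, ∑ a, m ⟨i, a⟩ = r i then
      PiTensorProduct.tprod ℂ fun i =>
        ⟨∏ a, SymmetricAlgebra.ι ℂ (V i) (β i a) ^ m ⟨i, a⟩, by
          rw [← h i]; exact prod_ι_pow_mem_symPow _ _ _⟩
    else 0

theorem component_monomial {r : Fin p → ℕ} {m : (Σ i, κ i) →₀ ℕ}
    (h : ∀ i, ∑ a, m ⟨i, a⟩ = r i) :
    component β r (MvPolynomial.monomial m 1) = PiTensorProduct.tprod ℂ fun i =>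
        ⟨∏ a, SymmetricAlgebra.ι ℂ (V i) (β i a) ^ m ⟨i, a⟩, by
          rw [← h i]; exact prod_ι_pow_mem_symPow _ _ _⟩ := by
  rw [← congrFun (MvPolynomial.coe_basisMonomials (Σ i, κ i) ℂ) m, component, Basis.constr_basis,
    dif_pos h]

theorem component_monomial_of_not {r : Fin p → ℕ} {m : (Σ i, κ i) →₀ ℕ}
    (h : ¬ ∀ i, ∑ a, m ⟨i, a⟩ = r i) : component β r (MvPolynomial.monomial m 1) = 0 := by
  rw [← congrFun (MvPolynomial.coe_basisMonomials (Σ i, κ i) ℂ) m, component, Basis.constr_basis,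
    dif_neg h]

/-- The ideal generated by the multilinear forms `A(f)` and the image of the multiplication map are
related by this formula: multiplying with a form of `V₁ ⊗ ⋯ ⊗ V_p` shifts the multidegree by one. -/
theorem component_tensorForm_mul (r : Fin p → ℕ) (t : ⨂[ℂ] i, V i)
    (q : MvPolynomial (Σ i, κ i) ℂ) :
    component β (fun i => r i + 1) (tensorForm β t * q) =
      PiTensorProduct.map₂ (fun i => symMul (V i) (r i)) t (component β r q) := by
  classical
  have h : LinearMap.compr₂ (LinearMap.mul ℂ _ ∘ₗ tensorForm β) (component β fun i => r i + 1) =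
      LinearMap.compl₂ (PiTensorProduct.map₂ (fun i => symMul (V i) (r i))) (component β r) := by
    refine (Basis.piTensorProduct β).ext fun J =>
      (MvPolynomial.basisMonomials (Σ i, κ i) ℂ).ext fun m => ?_
    rw [Basis.piTensorProduct_apply, MvPolynomial.coe_basisMonomials, LinearMap.compr₂_apply,
      LinearMap.comp_apply, tensorForm_tprod, LinearMap.mul_apply', LinearMap.compl₂_apply]
    let δ : (Σ i, κ i) →₀ ℕ := ∑ i, Finsupp.single ⟨i, J i⟩ 1
    have hδ : ∀ i a, δ ⟨i, a⟩ = if J i = a then 1 else 0 := fun i a => by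
      simp only [δ, Finsupp.finsetSum_apply, Finsupp.single_apply]
      rw [Finset.sum_eq_single i (fun j _ hj => if_neg fun h => hj (congrArg Sigma.fst h))
        (by simp)]
      simp
    have hmon : (∏ i, MvPolynomial.X ⟨i, J i⟩ : MvPolynomial (Σ i, κ i) ℂ) *
        MvPolynomial.monomial m 1 = MvPolynomial.monomial (δ + m) 1 := by
      have : (∏ i, MvPolynomial.X ⟨i, J i⟩ : MvPolynomial (Σ i, κ i) ℂ) =
          MvPolynomial.monomial δ 1 := by
        rw [MvPolynomial.monomial_sum_one]
        rfl
      rw [this, MvPolynomial.monomial_mul, one_mul]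
    have hdeg : ∀ i, ∑ a, (δ + m) ⟨i, a⟩ = ∑ a, m ⟨i, a⟩ + 1 := fun i => by
      simp [Finset.sum_add_distrib, hδ, add_comm]
    rw [hmon]
    by_cases h : ∀ i, ∑ a, m ⟨i, a⟩ = r i
    · rw [component_monomial β h, component_monomial β (fun i => by rw [hdeg, h]),
        PiTensorProduct.map₂_tprod_tprod]
      congr 1
      ext i
      have : ∏ a, SymmetricAlgebra.ι ℂ (V i) (β i a) ^ δ ⟨i, a⟩ =
          SymmetricAlgebra.ι ℂ (V i) (β i (J i)) := by
        simp only [hδ]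
        rw [Finset.prod_eq_single (J i) (fun a _ ha => by simp [ha.symm]) (by simp)]
        simp
      simp only [Finsupp.add_apply, pow_add, Finset.prod_mul_distrib, this]
      rfl
    · rw [component_monomial_of_not β h, component_monomial_of_not β (fun h' => h fun i => by
        have := h' i
        rw [hdeg] at this
        omega), map_zero]
  exact LinearMap.congr_fun₂ h t q

/-- If `A` is nondegenerate, then its rows, as multilinear forms, vanish simultaneously only where
all the coordinates of some `v_i` are zero. By the Nullstellensatz a power of each product
`∏ i, X (i, J i)` lies in the ideal of the rows, and in a sufficiently large multidegree every
monomial is divisible by one of these powers. -/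
theorem exists_mulMap_surjective (hV : ∀ i, Module.Finite ℂ (V i)) {A : MultiMatrix V₀ V}
    (hA : ¬ IsDegenerate A) : ∃ r : Fin p → ℕ, Function.Surjective (mulMap r A) := by
  classical
  let κ : Fin p → Type := fun i => Fin (finrank ℂ (V i))
  let β : ∀ i, Basis (κ i) ℂ (V i) := fun i => Module.finBasis ℂ (V i)
  let I : Ideal (MvPolynomial (Σ i, κ i) ℂ) :=
    Ideal.span (Set.range fun f : Dual ℂ V₀ => tensorForm β (toMap A f))
  have hrad : ∀ J : ∀ i, κ i, ∃ n, (∏ i, MvPolynomial.X ⟨i, J i⟩ : MvPolynomial (Σ i, κ i) ℂ) ^ n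
      ∈ I := by
    intro J
    change _ ∈ I.radical
    rw [← MvPolynomial.vanishingIdeal_zeroLocus_eq_radical (K := ℂ),
      MvPolynomial.mem_vanishingIdeal_iff]
    intro x hx
    rw [MvPolynomial.mem_zeroLocus_iff] at hx
    have hz : contract (fun i => ∑ c, x ⟨i, c⟩ • (β i).coord c) A = 0 := by
      rw [← Module.forall_dual_apply_eq_zero_iff ℂ]
      intro f
      rw [apply_contract, ← eval_tensorForm]
      exact hx _ (Ideal.subset_span ⟨f, rfl⟩)
    obtain ⟨i, hi⟩ : ∃ i, ∑ c, x ⟨i, c⟩ • (β i).coord c = 0 := by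
      by_contra! h
      exact hA ⟨_, h, hz⟩
    have hxi := congrArg (fun v => v (β i (J i))) hi
    simp only [LinearMap.sum_apply, LinearMap.smul_apply, Basis.coord_apply, Basis.repr_self,
      Finsupp.single_apply, smul_eq_mul, mul_ite, mul_one, mul_zero,
      LinearMap.zero_apply] at hxi
    rw [Finset.sum_ite_eq Finset.univ (J i), if_pos (Finset.mem_univ _)] at hxi
    rw [map_prod]
    exact Finset.prod_eq_zero (Finset.mem_univ i) (by simpa using hxi)
  choose n hn using hrad
  let N : ℕ := ∑ J, n J
  have hN : ∀ J : ∀ i, κ i, (∏ i, MvPolynomial.X ⟨i, J i⟩ : MvPolynomial (Σ i, κ i) ℂ) ^ N ∈ I :=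
    fun J => I.mem_of_dvd (pow_dvd_pow _ (Finset.single_le_sum (f := n)
      (fun _ _ => Nat.zero_le _) (Finset.mem_univ J))) (hn J)
  let r : Fin p → ℕ := fun i => Fintype.card (κ i) * N
  have hI : ∀ q ∈ I, component β (fun i => r i + 1) q ∈ LinearMap.range (mulMap r A) := by
    intro q hq
    have h : ∀ q', component β (fun i => r i + 1) (q' * q) ∈ LinearMap.range (mulMap r A) := by
      induction hq using Submodule.span_induction with
      | mem q hq =>
        obtain ⟨f, rfl⟩ := hq
        intro q'
        exact ⟨f ⊗ₜ[ℂ] component β r q', by rw [mulMap_tmul, mul_comm, component_tensorForm_mul]⟩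
      | zero => intro q'; rw [mul_zero, map_zero]; exact Submodule.zero_mem _
      | add x y _ _ hx hy =>
        intro q'; rw [mul_add, map_add]; exact Submodule.add_mem _ (hx q') (hy q')
      | smul a x _ hx => intro q'; rw [smul_eq_mul, ← mul_assoc]; exact hx _
    simpa using h 1
  refine ⟨r, ?_⟩
  -- a basis of the target consisting of tensor products of monomials
  have hspan : ∀ i, ⊤ ≤ Submodule.span ℂ {x : symPow (V i) (r i + 1) | ∃ d : κ i → ℕ,
      ∑ a, d a = r i + 1 ∧ (x : SymmetricAlgebra ℂ (V i)) =
        ∏ a, SymmetricAlgebra.ι ℂ (V i) (β i a) ^ d a} := by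
    intro i
    rintro ⟨s, hs⟩ -
    have h1 := symPow_le_span_monomials (β i) (r i + 1) hs
    have h2 : {x | ∃ d : κ i → ℕ, ∑ a, d a = r i + 1 ∧
        x = ∏ a, SymmetricAlgebra.ι ℂ (V i) (β i a) ^ d a} ⊆ (symPow (V i) (r i + 1)).subtype ''
          {x : symPow (V i) (r i + 1) | ∃ d : κ i → ℕ, ∑ a, d a = r i + 1 ∧
            (x : SymmetricAlgebra ℂ (V i)) = ∏ a, SymmetricAlgebra.ι ℂ (V i) (β i a) ^ d a} := by
      rintro _ ⟨d, hd, rfl⟩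
      refine ⟨⟨_, ?_⟩, ⟨d, hd, rfl⟩, rfl⟩
      rw [← hd]
      exact prod_ι_pow_mem_symPow _ _ _
    have h3 := Submodule.span_mono h2 h1
    rw [← Submodule.map_span] at h3
    obtain ⟨x, hx, hxs⟩ := h3
    have hx' : x = ⟨s, hs⟩ := Subtype.ext hxs
    rwa [← hx']
  let c := fun i => Basis.ofSpan (hspan i)
  rw [← LinearMap.range_eq_top, eq_top_iff, ← (Basis.piTensorProduct c).span_eq,
    Submodule.span_le]
  rintro _ ⟨j, rfl⟩
  rw [Basis.piTensorProduct_apply]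
  choose d hd hcd using fun i => Basis.ofSpan_subset (hspan i) ⟨j i, rfl⟩
  -- each monomial contains some variable with exponent at least `N`
  choose J hJ using fun i => show ∃ a, N ≤ d i a by
    by_contra! h
    have h1 := hd i
    have h2 : ∑ a, d i a ≤ ∑ _a : κ i, N := Finset.sum_le_sum fun a _ => (h a).le
    rw [Finset.sum_const, Finset.card_univ, smul_eq_mul, h1] at h2
    exact absurd h2 (Nat.not_succ_le_self _)
  let m : (Σ i, κ i) →₀ ℕ := Finsupp.equivFunOnFinite.symm fun x => d x.1 x.2
  have hm : component β (fun i => r i + 1) (MvPolynomial.monomial m 1) =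
      PiTensorProduct.tprod ℂ fun i => c i (j i) := by
    rw [component_monomial β (fun i => hd i)]
    congr 1
    ext i
    exact (hcd i).symm
  rw [← hm]
  refine hI _ (I.mem_of_dvd ?_ (hN J))
  have : (∏ i, MvPolynomial.X ⟨i, J i⟩ : MvPolynomial (Σ i, κ i) ℂ) ^ N =
      MvPolynomial.monomial (∑ i, Finsupp.single ⟨i, J i⟩ N) 1 := by
    rw [MvPolynomial.monomial_sum_one, ← Finset.prod_pow]
    simp only [MvPolynomial.X_pow_eq_monomial]
  rw [this, MvPolynomial.monomial_dvd_monomial]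
  refine ⟨Or.inr fun ⟨i, a⟩ => ?_, one_dvd _⟩
  rw [Finsupp.finsetSum_apply, Finset.sum_eq_single i (fun l _ hl => by
    rw [Finsupp.single_apply, if_neg fun h => hl (congrArg Sigma.fst h)]) (by simp),
    Finsupp.single_apply]
  split_ifs with h
  · cases h
    exact hJ i
  · exact Nat.zero_le _

/-- A nondegenerate matrix is separated from the degenerate ones by a polynomial. -/
theorem exists_eval_ne_zero_of_not_isDegenerate {k : Fin p → ℕ}
    (hV : ∀ i, finrank ℂ (V i) = k i + 1)
    {ι : Type*} [Fintype ι] (e : Basis ι ℂ (MultiMatrix V₀ V)) {A : MultiMatrix V₀ V}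
    (hA : ¬ IsDegenerate A) :
    ∃ M : MvPolynomial ι ℂ, MvPolynomial.eval (e.repr A) M ≠ 0 ∧
      ∀ B : MultiMatrix V₀ V, IsDegenerate B → MvPolynomial.eval (e.repr B) M = 0 := by
  obtain ⟨r, hr⟩ := exists_mulMap_surjective
    (fun i => Module.finite_of_finrank_pos (by rw [hV i]; omega)) hA
  have := fun i => finite_symPow (hV i) (r i + 1)
  obtain ⟨M, hM, hM'⟩ := exists_eval_ne_zero_of_surjective e
    (M := Dual ℂ V₀ ⊗[ℂ] (⨂[ℂ] i, symPow (V i) (r i)))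
    (M' := ⨂[ℂ] i, symPow (V i) (r i + 1)) (mulMap r) hr
  exact ⟨M, hM, fun B hB => hM' B (hB.not_surjective r)⟩

end Nullstellensatz

/-! ### Counting functions with prescribed fibre sizes -/

/-- The functions `α → Fin p` whose fibre over `i` has `k i` elements. -/
abbrev FibreFunction (α : Type*) [Fintype α] {p : ℕ} (k : Fin p → ℕ) : Type _ :=
  {σ : α → Fin p // ∀ i, Fintype.card {x // σ x = i} = k i}

theorem factorial_le_card_fibreFunction {α : Type*} [Fintype α] {p : ℕ} {k : Fin p → ℕ}
    (h : Fintype.card α = ∑ i, k i) :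
    (Fintype.card α).factorial ≤ (∏ i, (k i).factorial) * Nat.card (FibreFunction α k) := by
  classical
  rw [Nat.card_eq_fintype_card]
  let θ : α ≃ Σ i, Fin (k i) := Fintype.equivOfCardEq (by simp [h])
  let f : α → Fin p := fun x => (θ x).1
  have hf : ∀ i, Fintype.card {x // f x = i} = k i := fun i => by
    rw [← Fintype.card_fin (k i)]
    exact Fintype.card_congr ((θ.subtypeEquiv fun _ => Iff.rfl).trans (Equiv.sigmaSubtype i))
  have hg : ∀ (g : Equiv.Perm α) i, Fintype.card {x // (f ∘ g) x = i} = k i := fun g i => by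
    rw [← hf i]
    exact Fintype.card_congr (g.subtypeEquiv fun _ => Iff.rfl)
  let Φ : Equiv.Perm α → FibreFunction α k := fun g => ⟨f ∘ g, hg g⟩
  have hstab : Fintype.card {g : Equiv.Perm α // f ∘ g = f} = ∏ i, (k i).factorial := by
    rw [DomMulAct.stabilizer_card]
    simp only [hf]
  rw [← Fintype.card_perm, ← Finset.card_univ, ← Finset.card_univ (α := FibreFunction α k)]
  refine Finset.card_le_mul_card_image_of_maps_to (f := Φ) (fun _ _ => Finset.mem_univ _) _
    fun σ _ => ?_
  rcases Finset.eq_empty_or_nonempty (Finset.univ.filter fun g => Φ g = σ) with h0 | ⟨g₀, hg₀⟩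
  · rw [h0]; exact Nat.zero_le _
  -- the fibre through `g₀` is a coset of the stabilizer of `f`
  rw [← hstab, Fintype.card_subtype]
  refine Finset.card_le_card_of_injOn (fun g => g * g₀⁻¹) (fun g hg' => ?_)
    fun _ _ _ _ h => mul_right_cancel h
  have h1 : f ∘ g = f ∘ g₀ := congrArg Subtype.val
    ((Finset.mem_filter.1 hg').2.trans (Finset.mem_filter.1 hg₀).2.symm)
  refine Finset.mem_coe.2 (Finset.mem_filter.2 ⟨Finset.mem_univ _, funext fun x => ?_⟩)
  have := congrFun h1 (g₀⁻¹ x)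
  simpa using this

/-! ### The degree in a row and irreducibility of the determinant -/

section Determinant

variable {p : ℕ} {V₀ : Type*} {V : Fin p → Type*}
  [AddCommGroup V₀] [Module ℂ V₀] [∀ i, AddCommGroup (V i)] [∀ i, Module ℂ (V i)]
  {k₀ : ℕ} {k : Fin p → ℕ}

/-- The determinant of `∂_A` has degree at most `dim (S^{m₁}V₁ ⊗ ⋯ ⊗ S^{m_p}V_p)` in each row
of `A`, since a row enters only into the columns of the matrix of `∂_A` that belong to it. -/
theorem exists_det_del_pencil (hk : k₀ = ∑ i, k i) (hV : ∀ i, finrank ℂ (V i) = k i + 1)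
    (b : Basis (Fin (degN k₀ k)) ℂ (Source V₀ V k)) (c : Basis (Fin (degN k₀ k)) ℂ (Target V k))
    (b₀ : Basis (Fin (k₀ + 1)) ℂ V₀) (j : Fin (k₀ + 1)) (A : MultiMatrix V₀ V)
    (H : ⨂[ℂ] i, V i) :
    ∃ q : Polynomial ℂ, q.natDegree ≤ finrank ℂ (⨂[ℂ] i, symPow (V i) (mIdx k i)) ∧
      ∀ t, q.eval t = (LinearMap.toMatrix b c (del k (A + t • (b₀ j ⊗ₜ[ℂ] H)))).det := by
  classical
  have := fun i => finite_symPow (hV i) (mIdx k i)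
  let τ := Basis.piTensorProduct fun i => Module.finBasis ℂ (symPow (V i) (mIdx k i))
  have hτ : finrank ℂ (⨂[ℂ] i, symPow (V i) (mIdx k i)) = Fintype.card
    (∀ i, Fin (finrank ℂ (symPow (V i) (mIdx k i)))) := finrank_eq_card_basis τ
  let θ : Fin (k₀ + 1) × (∀ i, Fin (finrank ℂ (symPow (V i) (mIdx k i)))) ≃ Fin (degN k₀ k) :=
    Fintype.equivOfCardEq (by
      rw [Fintype.card_prod, ← hτ, Fintype.card_fin, Fintype.card_fin,
        succ_mul_finrank_tensor_symPow hk hV])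
  let b' : Basis (Fin (degN k₀ k)) ℂ (Source V₀ V k) :=
    (b₀.dualBasis.tensorProduct τ).reindex θ
  have hb' : ∀ l s, b' (θ (l, s)) = b₀.coord l ⊗ₜ[ℂ] τ s := fun l s => by
    simp [b']
  let S : Finset (Fin (degN k₀ k)) := Finset.univ.image fun s => θ (j, s)
  have hS : S.card = finrank ℂ (⨂[ℂ] i, symPow (V i) (mIdx k i)) := by
    rw [Finset.card_image_of_injective _ fun s s' h => (Prod.ext_iff.1 (θ.injective h)).2,
      Finset.card_univ, hτ]
  obtain ⟨q, hq, hqt⟩ := exists_det_add_smul_polynomial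
    (LinearMap.toMatrix b' c (mulMap (mIdx k) A))
    (LinearMap.toMatrix b' c (mulMap (mIdx k) (b₀ j ⊗ₜ[ℂ] H))) S fun i x hx => by
      obtain ⟨⟨l, s⟩, rfl⟩ := θ.surjective x
      have hl : l ≠ j := fun h => hx (by
        subst h; exact Finset.mem_image_of_mem _ (Finset.mem_univ s))
      rw [LinearMap.toMatrix_apply, hb', mulMap_tmul, toMap_tmul, Basis.coord_apply,
        Basis.repr_self, Finsupp.single_eq_of_ne hl, zero_smul, map_zero, LinearMap.zero_apply,
        map_zero, Finsupp.zero_apply]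
  refine ⟨q * Polynomial.C (b'.toMatrix b).det, ?_, fun t => ?_⟩
  · exact (Polynomial.natDegree_mul_C_le _ _).trans (hq.trans hS.le)
  · rw [Polynomial.eval_mul, hqt, Polynomial.eval_C, ← map_smul, ← map_add, ← map_smul, ← map_add,
      ← Matrix.det_mul, linearMap_toMatrix_mul_basis_toMatrix]
    rfl

theorem ofRows_update_add {n : ℕ} (b : Basis (Fin n) ℂ V₀) (F : Fin n → ⨂[ℂ] i, V i) (j : Fin n)
    (G H : ⨂[ℂ] i, V i) (t : ℂ) :
    ofRows b (Function.update F j (G + t • H)) =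
      ofRows b (Function.update F j G) + t • (b j ⊗ₜ[ℂ] H) := by
  classical
  have h : ∀ l, b l ⊗ₜ[ℂ] (Function.update F j (G + t • H) l) =
      b l ⊗ₜ[ℂ] (Function.update F j G l) + if l = j then t • (b j ⊗ₜ[ℂ] H) else 0 := by
    intro l
    rcases eq_or_ne l j with rfl | hl
    · simp [TensorProduct.tmul_add]
    · simp [hl]
  simp only [ofRows, h, Finset.sum_add_distrib, Finset.sum_ite_eq', Finset.mem_univ, if_true]

/-- If all the rows but the `j`-th one are proportional to decomposable tensors `⊗_i ℓ_i(l)` in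
general position, then for every distribution of these rows into groups of sizes `k₁, …, k_p`
there is a point at which the rows of the `i`-th group vanish on account of their `i`-th
factor. These linear forms in the `j`-th row are pairwise nonproportional and do not vanish
at `⊗_i ℓ_i(j)`. -/
theorem exists_evaluation_points {ℓ : ∀ i, Fin (k₀ + 1) → V i}
    (hV : ∀ i, finrank ℂ (V i) = k i + 1) (hℓ : ∀ i, GeneralPosition (k i) (ℓ i))
    (b₀ : Basis (Fin (k₀ + 1)) ℂ V₀) (j : Fin (k₀ + 1)) :
    ∃ x : FibreFunction {l // l ≠ j} k → Dual ℂ (⨂[ℂ] i, V i),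
      (∀ σ, x σ (PiTensorProduct.tprod ℂ fun i => ℓ i j) ≠ 0) ∧
      (∀ σ τ, σ ≠ τ → ∃ w, x σ w = 0 ∧ x τ w ≠ 0) ∧
      ∀ σ (c : Fin (k₀ + 1) → ℂ) (G : ⨂[ℂ] i, V i), x σ G = 0 →
        IsDegenerate (ofRows b₀ (Function.update
          (fun l => c l • PiTensorProduct.tprod ℂ fun i => ℓ i l) j G)) := by
  classical
  let S : FibreFunction {l // l ≠ j} k → ∀ _ : Fin p, Finset (Fin (k₀ + 1)) := fun σ i =>
    (Finset.univ.filter fun l => σ.1 l = i).map (Function.Embedding.subtype _)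
  have hS : ∀ σ i, (S σ i).card = k i := fun σ i => by
    rw [Finset.card_map, ← σ.2 i, Fintype.card_subtype]
  have hmem : ∀ σ i (l : {l // l ≠ j}), l.1 ∈ S σ i ↔ σ.1 l = i := fun σ i l => by
    simp [S, l.2]
  have hj : ∀ σ i, j ∉ S σ i := fun σ i => by simp [S]
  choose v hv using fun σ i => (hℓ i).exists_dual (hV i) (hS σ i)
  refine ⟨fun σ => PiTensorProduct.dualDistrib (PiTensorProduct.tprod ℂ (v σ)), fun σ => ?_,
    fun σ τ hne => ?_, fun σ c G hG => ?_⟩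
  · rw [PiTensorProduct.dualDistrib_apply, Finset.prod_ne_zero_iff]
    exact fun i _ h => hj σ i ((hv σ i j).1 h)
  · obtain ⟨l, hl⟩ : ∃ l, σ.1 l ≠ τ.1 l := by
      by_contra! h
      exact hne (Subtype.ext (funext h))
    let w : ∀ i, V i := fun i => if i = σ.1 l then ℓ i l else ℓ i j
    refine ⟨PiTensorProduct.tprod ℂ w, ?_, ?_⟩
    · rw [PiTensorProduct.dualDistrib_apply]
      refine Finset.prod_eq_zero (Finset.mem_univ (σ.1 l)) ?_
      change v σ _ (if σ.1 l = σ.1 l then _ else _) = 0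
      rw [if_pos rfl]
      exact (hv σ _ _).2 ((hmem σ _ l).2 rfl)
    · rw [PiTensorProduct.dualDistrib_apply, Finset.prod_ne_zero_iff]
      intro i _
      change v τ i (if i = σ.1 l then ℓ i l else ℓ i j) ≠ 0
      split_ifs with hi
      · exact fun h => hl (hi ▸ ((hmem τ i l).1 ((hv τ i l).1 h)).symm)
      · exact fun h => hj τ i ((hv τ i j).1 h)
  · refine ⟨v σ, fun i h0 => hj σ i ((hv σ i j).1 (by rw [h0, LinearMap.zero_apply])), ?_⟩
    rw [toDualMap_tprod, contract_ofRows_eq_zero_iff]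
    intro l
    rcases eq_or_ne l j with rfl | hl
    · rwa [Function.update_self]
    · rw [Function.update_of_ne hl, map_smul, PiTensorProduct.dualDistrib_apply,
        Finset.prod_eq_zero (Finset.mem_univ (σ.1 ⟨l, hl⟩)), smul_zero]
      exact (hv σ _ _).2 ((hmem σ _ ⟨l, hl⟩).2 rfl)

theorem surjective_mulMap_of_det_del_ne_zero (b : Basis (Fin (degN k₀ k)) ℂ (Source V₀ V k))
    (c : Basis (Fin (degN k₀ k)) ℂ (Target V k)) (A : MultiMatrix V₀ V)
    (h : (LinearMap.toMatrix b c (del k A)).det ≠ 0) :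
    Function.Surjective (mulMap (mIdx k) A) :=
  surjective_of_det_ne_zero b c (del k A) h

theorem det_del_ne_zero_of_surjective (b : Basis (Fin (degN k₀ k)) ℂ (Source V₀ V k))
    (c : Basis (Fin (degN k₀ k)) ℂ (Target V k)) (A : MultiMatrix V₀ V)
    (h : Function.Surjective (mulMap (mIdx k) A)) :
    (LinearMap.toMatrix b c (del k A)).det ≠ 0 :=
  det_ne_zero_of_surjective b c (del k A) h

theorem det_del_smul (b : Basis (Fin (degN k₀ k)) ℂ (Source V₀ V k))
    (c : Basis (Fin (degN k₀ k)) ℂ (Target V k)) (t : ℂ) (A : MultiMatrix V₀ V) :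
    (LinearMap.toMatrix b c (del k (t • A))).det =
      t ^ degN k₀ k * (LinearMap.toMatrix b c (del k A)).det := by
  have h := det_toMatrix_smul b c t
    (mulMap (mIdx k) A)
  rw [← map_smul, Fintype.card_fin] at h
  exact h

theorem finrank_le_card_fibreFunction (hk : k₀ = ∑ i, k i) (hV : ∀ i, finrank ℂ (V i) = k i + 1)
    (j : Fin (k₀ + 1)) :
    finrank ℂ (⨂[ℂ] i, symPow (V i) (mIdx k i)) ≤ Nat.card (FibreFunction {l // l ≠ j} k) := by
  have hc : Fintype.card {l // l ≠ j} = k₀ := by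
    rw [Fintype.card_subtype_compl, Fintype.card_fin, Fintype.card_subtype_eq,
      Nat.add_sub_cancel]
  have h := factorial_le_card_fibreFunction (α := {l // l ≠ j}) (k := k) (by rw [hc, hk])
  rw [hc, ← finrank_tensor_symPow_mul hk hV, mul_comm] at h
  exact Nat.le_of_mul_le_mul_left h prod_factorial_pos

/-- If `det ∂_A = Q R`, where `Q` vanishes on the degenerate matrices, then at matrices with
decomposable rows in general position `R` does not change when a row is rescaled. Indeed, on a
generic line in the space of `j`-th rows the determinant has degree at most
`d = dim (S^{m₁}V₁ ⊗ ⋯ ⊗ S^{m_p}V_p)`, while `Q` has a zero for each of the `d` evaluation points;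
so `R` is constant on such lines, and two of them connect a row with its multiples. -/
theorem eval_cofactor_update (hk : k₀ = ∑ i, k i) (hV : ∀ i, finrank ℂ (V i) = k i + 1)
    (b : Basis (Fin (degN k₀ k)) ℂ (Source V₀ V k)) (c : Basis (Fin (degN k₀ k)) ℂ (Target V k))
    {ι : Type*} (e : Basis ι ℂ (MultiMatrix V₀ V)) {Q R : MvPolynomial ι ℂ}
    (hQR : ∀ A : MultiMatrix V₀ V,
      MvPolynomial.eval (e.repr A) (Q * R) = (LinearMap.toMatrix b c (del k A)).det)
    (hQ : ∀ A : MultiMatrix V₀ V, IsDegenerate A → MvPolynomial.eval (e.repr A) Q = 0)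
    (b₀ : Basis (Fin (k₀ + 1)) ℂ V₀) {ℓ : ∀ i, Fin (k₀ + 1) → V i}
    (hℓ : ∀ i, GeneralPosition (k i) (ℓ i)) {a : Fin (k₀ + 1) → ℂ} (ha : ∀ l, a l ≠ 0)
    (j : Fin (k₀ + 1)) {u : ℂ} (hu : u ≠ 0) :
    MvPolynomial.eval (e.repr (ofRows b₀ fun l =>
        Function.update a j u l • PiTensorProduct.tprod ℂ fun i => ℓ i l)) R =
      MvPolynomial.eval (e.repr (ofRows b₀ fun l =>
        a l • PiTensorProduct.tprod ℂ fun i => ℓ i l)) R := by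
  classical
  obtain ⟨x, hxT, hx, hdeg⟩ := exists_evaluation_points hV hℓ b₀ j
  set T : ⨂[ℂ] i, V i := PiTensorProduct.tprod ℂ fun i => ℓ i j with hT
  let F : Fin (k₀ + 1) → ⨂[ℂ] i, V i := fun l => a l • PiTensorProduct.tprod ℂ fun i => ℓ i l
  let Φ := FibreFunction {l // l ≠ j} k
  have hupd : ∀ w : ℂ, (fun l => Function.update a j w l • PiTensorProduct.tprod ℂ fun i => ℓ i l) =
      Function.update F j (w • T) := by
    intro w
    ext l
    rcases eq_or_ne l j with rfl | hl
    · simp [hT]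
    · simp [F, hl]
  -- the second endpoint `H` of the lines
  obtain ⟨H', hH'⟩ := Module.Dual.exists_forall_ne_zero_of_forall_exists (K := ℂ)
    (Sum.elim x fun st : {st : Φ × Φ // st.1 ≠ st.2} =>
      x st.1.1 T • x st.1.2 - x st.1.2 T • x st.1.1) (by
      rintro (σ | ⟨⟨σ, τ⟩, hne⟩)
      · exact ⟨T, hxT σ⟩
      · obtain ⟨w, hw, hw'⟩ := hx σ τ hne
        refine ⟨w, ?_⟩
        simp only [Sum.elim_inr, LinearMap.sub_apply, LinearMap.smul_apply, hw, smul_eq_mul,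
          mul_zero, sub_zero]
        exact mul_ne_zero (hxT σ) hw')
  obtain ⟨s, hs⟩ := Infinite.exists_notMem_finset (insert 0
    (Finset.univ.image (fun σ : Φ => a j * x σ T / x σ H') ∪
      Finset.univ.image (fun σ : Φ => u * x σ T / x σ H')))
  simp only [Finset.mem_insert, Finset.mem_union, Finset.mem_image, Finset.mem_univ, true_and,
    not_or, not_exists] at hs
  obtain ⟨hs0, hsa, hsu⟩ := hs
  have hH1 : ∀ σ, x σ H' ≠ 0 := fun σ => hH' (Sum.inl σ)
  have key : ∀ w : ℂ, w ≠ 0 → (∀ σ, ¬ w * x σ T / x σ H' = s) →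
      MvPolynomial.eval (e.repr (ofRows b₀ (Function.update F j (w • T)))) R =
        MvPolynomial.eval (e.repr (ofRows b₀ (Function.update F j (s • H')))) R := by
    intro w hw0 hws
    let K : ⨂[ℂ] i, V i := s • H' - w • T
    have hK : ∀ σ, x σ K ≠ 0 := fun σ h => hws σ (by
      simp only [K, map_sub, map_smul, smul_eq_mul] at h
      rw [div_eq_iff (hH1 σ)]
      linear_combination -h)
    obtain ⟨q, hq, hqt⟩ := exists_det_del_pencil hk hV b c b₀ j
      (ofRows b₀ (Function.update F j (w • T))) K
    have hcurve : (fun t : ℂ => ofRows b₀ (Function.update F j (w • T)) + t • (b₀ j ⊗ₜ[ℂ] K)) ∈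
        polyCurves (MultiMatrix V₀ V) := add_smul_mem_polyCurves _ _
    obtain ⟨φ, hφ⟩ := exists_eval_curve e hcurve
    simp only [← ofRows_update_add] at hφ hqt
    have hφq : φ Q * φ R = q := Polynomial.funext fun t => by
      rw [← map_mul, hφ, hQR, hqt]
    have hne : φ Q * φ R ≠ 0 := by
      intro h0
      have h1 := hqt 0
      rw [← hφq, h0, Polynomial.eval_zero, zero_smul, add_zero, ← hupd] at h1
      refine det_del_ne_zero_of_surjective b c _
        (mulMap_ofRows_surjective hk b₀ hℓ fun l => ?_) h1.symm
      rcases eq_or_ne l j with rfl | hl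
      · simpa using hw0
      · simpa [hl] using ha l
    -- the zeros of `Q` on the line: there `x σ` vanishes at the `j`-th row
    let ρ : Φ → ℂ := fun σ => -(w * x σ T) / x σ K
    have hρ : Function.Injective ρ := by
      intro σ τ h
      by_contra hστ
      refine hH' (Sum.inr ⟨(σ, τ), hστ⟩) ?_
      simp only [ρ, div_eq_div_iff (hK σ) (hK τ)] at h
      simp only [K, map_sub, map_smul, smul_eq_mul] at h
      simp only [Sum.elim_inr, LinearMap.sub_apply, LinearMap.smul_apply, smul_eq_mul]
      refine (mul_eq_zero.1 (?_ : (w * s) * _ = 0)).resolve_left (mul_ne_zero hw0 hs0)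
      linear_combination -h
    have := eval_eq_eval_of_card_roots_le hne (hφq ▸ hq) (S := Finset.univ.image ρ)
      (fun t ht => by
        obtain ⟨σ, -, rfl⟩ := Finset.mem_image.1 ht
        rw [hφ]
        refine hQ _ (hdeg σ a _ ?_)
        simp only [map_add, map_smul, smul_eq_mul, ρ]
        rw [div_mul_cancel₀ _ (hK σ), add_neg_cancel])
      (by
        rw [Finset.card_image_of_injective _ hρ, Finset.card_univ, ← Nat.card_eq_fintype_card]
        exact finrank_le_card_fibreFunction hk hV j) 0 1
    rw [hφ, hφ] at this
    simpa [K] using this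
  have hFa : (fun l => a l • PiTensorProduct.tprod ℂ fun i => ℓ i l) =
      Function.update F j (a j • T) := by
    rw [← hupd, Function.update_eq_self]
  rw [hFa, hupd, key u hu hsu, key (a j) (ha j) hsa]

/-- In the situation of `eval_cofactor_update`, the polynomial `Q` has at least the degree of
the determinant, since it grows like the determinant on a line through the origin. -/
theorem degN_le_totalDegree (hk : k₀ = ∑ i, k i)
    (hV₀ : finrank ℂ V₀ = k₀ + 1) (hV : ∀ i, finrank ℂ (V i) = k i + 1)
    (b : Basis (Fin (degN k₀ k)) ℂ (Source V₀ V k)) (c : Basis (Fin (degN k₀ k)) ℂ (Target V k))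
    {ι : Type*} (e : Basis ι ℂ (MultiMatrix V₀ V)) {Q R : MvPolynomial ι ℂ}
    (hQR : ∀ A : MultiMatrix V₀ V,
      MvPolynomial.eval (e.repr A) (Q * R) = (LinearMap.toMatrix b c (del k A)).det)
    (hQ : ∀ A : MultiMatrix V₀ V, IsDegenerate A → MvPolynomial.eval (e.repr A) Q = 0) :
    degN k₀ k ≤ Q.totalDegree := by
  classical
  have : Module.Finite ℂ V₀ := Module.finite_of_finrank_pos (by omega)
  let b₀ := Module.finBasisOfFinrankEq ℂ V₀ hV₀
  choose ℓ hℓ using fun i => exists_generalPosition (hV i) (k₀ + 1)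
  let D : (Fin (k₀ + 1) → ℂ) → MultiMatrix V₀ V := fun a =>
    ofRows b₀ fun l => a l • PiTensorProduct.tprod ℂ fun i => ℓ i l
  have hD : ∀ t : ℂ, D (fun _ => t) = t • D 1 := fun t => by
    simp [D, ofRows, Finset.smul_sum]
  have hdet : (LinearMap.toMatrix b c (del k (D 1))).det ≠ 0 :=
    det_del_ne_zero_of_surjective b c _ (mulMap_ofRows_surjective hk b₀ hℓ fun _ => one_ne_zero)
  have hR : ∀ t : ℂ, t ≠ 0 → MvPolynomial.eval (e.repr (D fun _ => t)) R =
      MvPolynomial.eval (e.repr (D 1)) R := by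
    intro t ht
    have h : ∀ s : Finset (Fin (k₀ + 1)),
        MvPolynomial.eval (e.repr (D (s.piecewise (fun _ => t) 1))) R =
          MvPolynomial.eval (e.repr (D 1)) R := by
      intro s
      induction s using Finset.induction_on with
      | empty => simp
      | insert j s _ ih =>
        rw [← ih, Finset.piecewise_insert]
        refine eval_cofactor_update hk hV b c e hQR hQ b₀ hℓ (fun l => ?_) j ht
        by_cases hl : l ∈ s <;> simp [hl, ht]
    simpa using h Finset.univ
  have h1 := hQR (D 1)
  rw [map_mul] at h1
  have hQ1 : MvPolynomial.eval (e.repr (D 1)) Q ≠ 0 := left_ne_zero_of_mul (h1 ▸ hdet)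
  have hR1 : MvPolynomial.eval (e.repr (D 1)) R ≠ 0 := right_ne_zero_of_mul (h1 ▸ hdet)
  have hQt : ∀ t : ℂ, t ≠ 0 → MvPolynomial.eval (e.repr (D fun _ => t)) Q =
      t ^ degN k₀ k * MvPolynomial.eval (e.repr (D 1)) Q := by
    intro t ht
    have h2 := hQR (D fun _ => t)
    rw [map_mul, hR t ht, hD, det_del_smul, ← hD, ← h1, ← mul_assoc] at h2
    exact mul_right_cancel₀ hR1 h2
  let γ : ι → Polynomial ℂ := fun i => Polynomial.C (e.repr (D 1) i) * Polynomial.X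
  have hγ : MvPolynomial.aeval γ Q =
      Polynomial.C (MvPolynomial.eval (e.repr (D 1)) Q) * Polynomial.X ^ degN k₀ k := by
    refine Polynomial.eq_of_infinite_eval_eq _ _
      ((Set.finite_singleton (0 : ℂ)).infinite_compl.mono fun t ht => ?_)
    have h4 : (MvPolynomial.aeval γ Q).eval t =
        MvPolynomial.eval (e.repr (D fun _ => t)) Q := by
      have h : (Polynomial.evalRingHom t).comp (MvPolynomial.aeval γ).toRingHom =
          MvPolynomial.eval (e.repr (D fun _ => t)) := by
        apply MvPolynomial.ringHom_ext
        · intro c; simp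
        · intro i
          rw [hD, map_smul]
          simp only [γ, RingHom.comp_apply, AlgHom.toRingHom_eq_coe, RingHom.coe_coe,
            MvPolynomial.aeval_X, MvPolynomial.eval_X, Polynomial.coe_evalRingHom,
            Polynomial.eval_mul, Polynomial.eval_C, Polynomial.eval_X, Finsupp.smul_apply,
            smul_eq_mul]
          exact mul_comm _ _
      exact congrArg (fun f => f Q) h
    change (MvPolynomial.aeval γ Q).eval t = _
    rw [h4, hQt t ht, Polynomial.eval_mul, Polynomial.eval_C, Polynomial.eval_pow,
      Polynomial.eval_X, mul_comm]
  have h5 := MvPolynomial.aeval_natDegree_le (n := 1) Q le_rfl γ fun i =>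
    (Polynomial.natDegree_C_mul_le _ _).trans Polynomial.natDegree_X_le
  rwa [hγ, Polynomial.natDegree_C_mul_X_pow _ _ hQ1, mul_one] at h5

theorem one_le_degN (hk : k₀ = ∑ i, k i) : 1 ≤ degN k₀ k := by
  have h := degN_mul k₀ k hk
  rcases Nat.eq_zero_or_pos (degN k₀ k) with h0 | h0
  · rw [h0, zero_mul] at h
    exact absurd h (Nat.factorial_ne_zero _).symm
  · exact h0

end Determinant

/-! ### The hypersurface of degenerate matrices -/

section Hypersurface

variable {p : ℕ} {V₀ : Type*} {V : Fin p → Type*}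
  [AddCommGroup V₀] [Module ℂ V₀] [∀ i, AddCommGroup (V i)] [∀ i, Module ℂ (V i)]
  {k₀ : ℕ} {k : Fin p → ℕ}

/-- The determinant of `∂_A` is an irreducible form of degree `N`, which generates the ideal of the
set of degenerate matrices and vanishes on this set only. -/
theorem exists_irreducible_det_del (hk : k₀ = ∑ i, k i)
    (hV₀ : finrank ℂ V₀ = k₀ + 1) (hV : ∀ i, finrank ℂ (V i) = k i + 1)
    (b : Basis (Fin (degN k₀ k)) ℂ (Source V₀ V k)) (c : Basis (Fin (degN k₀ k)) ℂ (Target V k))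
    {ι : Type*} [Fintype ι] (e : Basis ι ℂ (MultiMatrix V₀ V)) :
    ∃ P : MvPolynomial ι ℂ,
      (∀ A : MultiMatrix V₀ V,
        MvPolynomial.eval (e.repr A) P = (LinearMap.toMatrix b c (del k A)).det) ∧
      P.IsHomogeneous (degN k₀ k) ∧ Irreducible P ∧
      (∀ G : MvPolynomial ι ℂ, (∀ A : MultiMatrix V₀ V, IsDegenerate A →
        MvPolynomial.eval (e.repr A) G = 0) → P ∣ G) ∧
      ∀ A : MultiMatrix V₀ V, IsDegenerate A ↔ MvPolynomial.eval (e.repr A) P = 0 := by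
  classical
  obtain ⟨P, hP, hhom⟩ := exists_det_polynomial e
    ((LinearMap.toMatrix b c).toLinearMap ∘ₗ mulMap (mIdx k))
  replace hP : ∀ A : MultiMatrix V₀ V,
    MvPolynomial.eval (e.repr A) P = (LinearMap.toMatrix b c (del k A)).det := hP
  rw [Fintype.card_fin] at hhom
  have hPZ : ∀ A : MultiMatrix V₀ V, IsDegenerate A → MvPolynomial.eval (e.repr A) P = 0 := by
    intro A hA
    rw [hP]
    by_contra h
    exact hA.not_surjective (mIdx k) (surjective_mulMap_of_det_del_ne_zero b c A h)
  have hdegP : ∀ Q R : MvPolynomial ι ℂ, P = Q * R →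
      (∀ A : MultiMatrix V₀ V, IsDegenerate A → MvPolynomial.eval (e.repr A) Q = 0) →
      degN k₀ k ≤ Q.totalDegree := fun Q R hQR hQ =>
    degN_le_totalDegree hk hV₀ hV b c e (fun A => by rw [← hQR, hP]) hQ
  have hP1 : degN k₀ k ≤ P.totalDegree := hdegP P 1 (mul_one P).symm hPZ
  have hN := one_le_degN hk
  have hP0 : P ≠ 0 := by
    rintro rfl
    rw [MvPolynomial.totalDegree_zero] at hP1
    omega
  have htot : P.totalDegree = degN k₀ k := hhom.totalDegree hP0
  -- of two factors of `P` one vanishes on the degenerate matrices, so that the other is constant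
  have hunit : ∀ Q R : MvPolynomial ι ℂ, P = Q * R →
      (∀ A : MultiMatrix V₀ V, IsDegenerate A → MvPolynomial.eval (e.repr A) Q = 0) →
      IsUnit R := by
    intro Q R hQR hQ
    have h1 := hdegP Q R hQR hQ
    have hQ0 : Q ≠ 0 := fun h => hP0 (by rw [hQR, h, zero_mul])
    have hR0 : R ≠ 0 := fun h => hP0 (by rw [hQR, h, mul_zero])
    have h2 := MvPolynomial.totalDegree_mul_of_isDomain hQ0 hR0
    rw [← hQR, htot] at h2
    rw [MvPolynomial.isUnit_iff_totalDegree_of_isReduced]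
    have h3 : R.totalDegree = 0 := by omega
    refine ⟨isUnit_iff_ne_zero.2 fun h => hR0 ?_, h3⟩
    rw [MvPolynomial.totalDegree_eq_zero_iff_eq_C.1 h3, h, map_zero]
  have hirr : Irreducible P := by
    refine ⟨fun h => ?_, fun Q R hQR => ?_⟩
    · rw [MvPolynomial.isUnit_iff_totalDegree_of_isReduced] at h
      omega
    · rcases forall_eval_eq_zero_of_mul e (f := Q) (g := R) (fun A hA => by
        have := hPZ A hA
        rwa [hQR, map_mul, mul_eq_zero] at this) with h | h
      · exact Or.inr (hunit Q R hQR h)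
      · exact Or.inl (hunit R Q (by rw [hQR, mul_comm]) h)
  obtain ⟨i₀, hi₀⟩ : P.vars.Nonempty := by
    rw [Finset.nonempty_iff_ne_empty]
    intro h
    rw [MvPolynomial.vars_eq_empty_iff_eq_C, ← MvPolynomial.totalDegree_eq_zero_iff_eq_C] at h
    omega
  have hdvd : ∀ G : MvPolynomial ι ℂ, (∀ A : MultiMatrix V₀ V, IsDegenerate A →
      MvPolynomial.eval (e.repr A) G = 0) → P ∣ G := by
    intro G hG
    by_contra hPG
    -- otherwise eliminate a coordinate from `P` and `G`; the result is invariant in a direction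
    obtain ⟨R, hR, hR0, hinv⟩ := exists_mem_span_pair_eval_eq hirr hi₀ hPG
    obtain ⟨s, t, rfl⟩ := Ideal.mem_span_pair.1 hR
    refine hR0 (eq_zero_of_forall_isDegenerate hk hV₀ hV e (e.ne_zero i₀) (fun A hA => ?_)
      fun A z => hinv _ _ fun i hi => ?_)
    · rw [map_add, map_mul, map_mul, hPZ A hA, hG A hA, mul_zero, mul_zero, add_zero]
    · rw [map_add, map_smul, e.repr_self, Finsupp.add_apply, Finsupp.smul_apply,
        Finsupp.single_eq_of_ne hi, smul_zero, add_zero]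
  refine ⟨P, hP, hhom, hirr, hdvd, fun A => ⟨hPZ A, fun h => ?_⟩⟩
  by_contra hA
  -- `M` is a multiple of `P` that does not vanish at `A`
  obtain ⟨M, hM, hMZ⟩ := exists_eval_ne_zero_of_not_isDegenerate hV e hA
  obtain ⟨R, rfl⟩ := hdvd M hMZ
  exact hM (by rw [map_mul, h, zero_mul])

theorem isDegenerate_zero (hV : ∀ i, finrank ℂ (V i) = k i + 1) :
    IsDegenerate (0 : MultiMatrix V₀ V) := by
  have h : ∀ i, ∃ v : Dual ℂ (V i), v ≠ 0 := fun i => by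
    have : Module.Finite ℂ (V i) := Module.finite_of_finrank_pos (by rw [hV i]; omega)
    have : Nontrivial (Dual ℂ (V i)) := Module.nontrivial_of_finrank_pos (R := ℂ) (by
      rw [Subspace.dual_finrank_eq, hV i]; omega)
    exact exists_ne 0
  choose v hv using h
  exact ⟨v, hv, by rw [toDualMap_tprod, map_zero]⟩

theorem isIrreducibleVariety_image {ι : Type*} [Fintype ι] (e : Basis ι ℂ (MultiMatrix V₀ V))
    (hV : ∀ i, finrank ℂ (V i) = k i + 1) {P : MvPolynomial ι ℂ}
    (hP : ∀ A : MultiMatrix V₀ V, IsDegenerate A ↔ MvPolynomial.eval (e.repr A) P = 0) :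
    IsIrreducibleVariety (e.equivFun '' {A | IsDegenerate A}) := by
  refine ⟨⟨Ideal.span {P}, ?_⟩, ⟨_, 0, isDegenerate_zero hV, rfl⟩, fun I J h => ?_⟩
  · rw [MvPolynomial.zeroLocus_span]
    ext x
    constructor
    · rintro ⟨A, hA, rfl⟩ Q rfl
      exact (hP A).1 hA
    · intro hx
      refine ⟨e.equivFun.symm x, (hP _).2 ?_, e.equivFun.apply_symm_apply x⟩
      have := hx P rfl
      rwa [← e.equivFun_apply, LinearEquiv.apply_symm_apply]
  · by_contra! hIJ
    obtain ⟨hI, hJ⟩ := hIJ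
    obtain ⟨_, ⟨A, hA, rfl⟩, hAI⟩ := Set.not_subset.1 hI
    obtain ⟨_, ⟨B, hB, rfl⟩, hBJ⟩ := Set.not_subset.1 hJ
    rw [MvPolynomial.mem_zeroLocus_iff] at hAI hBJ
    push Not at hAI hBJ
    obtain ⟨f, hf, hfA⟩ := hAI
    obtain ⟨g, hg, hgB⟩ := hBJ
    rcases forall_eval_eq_zero_of_mul e (f := f) (g := g) (fun C hC => by
      rcases h ⟨C, hC, rfl⟩ with h | h
      · exact Or.inl (h f hf)
      · exact Or.inr (h g hg)) with h | h
    · exact hfA (h A hA)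
    · exact hgB (h B hB)

theorem isHypersurfaceWithEquation_image {ι : Type*} [Fintype ι]
    (e : Basis ι ℂ (MultiMatrix V₀ V)) {P : MvPolynomial ι ℂ} {d : ℕ} (hd : 1 ≤ d)
    (hhom : P.IsHomogeneous d) (hP0 : P ≠ 0)
    (hdvd : ∀ G : MvPolynomial ι ℂ, (∀ A : MultiMatrix V₀ V, IsDegenerate A →
      MvPolynomial.eval (e.repr A) G = 0) → P ∣ G)
    (hP : ∀ A : MultiMatrix V₀ V, IsDegenerate A ↔ MvPolynomial.eval (e.repr A) P = 0) :
    IsHypersurfaceWithEquation (e.equivFun '' {A | IsDegenerate A}) P d := by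
  refine ⟨hhom.totalDegree hP0, hd, ?_, ?_⟩
  · ext x
    constructor
    · rintro ⟨A, hA, rfl⟩
      exact (hP A).1 hA
    · intro hx
      refine ⟨e.equivFun.symm x, (hP _).2 ?_, e.equivFun.apply_symm_apply x⟩
      rwa [← e.equivFun_apply, LinearEquiv.apply_symm_apply]
  · ext G
    rw [MvPolynomial.mem_vanishingIdeal_iff, Ideal.mem_span_singleton]
    refine ⟨fun h => hdvd G fun A hA => h _ ⟨A, hA, rfl⟩, ?_⟩
    rintro ⟨R, rfl⟩ _ ⟨A, hA, rfl⟩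
    have h : MvPolynomial.aeval (e.equivFun A) P = 0 := (hP A).1 hA
    rw [map_mul, h, zero_mul]

end Hypersurface

end BoundaryFormat

end

open BoundaryFormat in
theorem theorem3p1 {p : ℕ} (k₀ : ℕ) (k : Fin p → ℕ) (hk : k₀ = ∑ i, k i)
    (V₀ : Type*) (V : Fin p → Type*)
    [AddCommGroup V₀] [Module ℂ V₀] [∀ i, AddCommGroup (V i)] [∀ i, Module ℂ (V i)]
    (hV₀ : Module.finrank ℂ V₀ = k₀ + 1) (hV : ∀ i, Module.finrank ℂ (V i) = k i + 1) :
    -- the source and the target of `∂_A` both have dimension `N`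
    Module.finrank ℂ (Source V₀ V k) = degN k₀ k ∧
    Module.finrank ℂ (Target V k) = degN k₀ k ∧
    -- for the determinant of `∂_A` with respect to any bases of source and target:
    ∀ (b : Module.Basis (Fin (degN k₀ k)) ℂ (Source V₀ V k))
      (c : Module.Basis (Fin (degN k₀ k)) ℂ (Target V k)),
      -- `A` is nondegenerate iff `det ∂_A ≠ 0`
      (∀ A : MultiMatrix V₀ V,
        ¬ IsDegenerate A ↔ (LinearMap.toMatrix b c (del k A)).det ≠ 0) ∧
      -- in any linear coordinates on the space of matrices, `det ∂_A` is a polynomial `P` in the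
      -- coordinates of `A`, and the degenerate matrices form an irreducible hypersurface of
      -- degree `N` with equation `P = 0`
      ∀ {ι : Type*} [Fintype ι] (e : Module.Basis ι ℂ (MultiMatrix V₀ V)),
        ∃ P : MvPolynomial ι ℂ,
          (∀ A : MultiMatrix V₀ V,
            MvPolynomial.eval (e.repr A) P = (LinearMap.toMatrix b c (del k A)).det) ∧
          P.IsHomogeneous (degN k₀ k) ∧
          Irreducible P ∧
          IsIrreducibleVariety (e.equivFun '' {A | IsDegenerate A}) ∧
          IsHypersurfaceWithEquation (e.equivFun '' {A | IsDegenerate A}) P (degN k₀ k) := by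
  refine ⟨finrank_source hk hV₀ hV, finrank_target hk hV, fun b c => ⟨fun A => ?_, ?_⟩⟩
  · have : Module.Finite ℂ V₀ := Module.finite_of_finrank_pos (by omega)
    have := fun i => Module.finite_of_finrank_pos (R := ℂ) (M := V i) (by rw [hV i]; omega)
    obtain ⟨P, hP, -, -, -, hZ⟩ := exists_irreducible_det_del hk hV₀ hV b c
      ((Module.finBasis ℂ V₀).tensorProduct
        (Basis.piTensorProduct fun i => Module.finBasis ℂ (V i)))
    rw [hZ, hP]
  · intro ι _ e
    obtain ⟨P, hP, hhom, hirr, hdvd, hZ⟩ := exists_irreducible_det_del hk hV₀ hV b c e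
    exact ⟨P, hP, hhom, hirr, isIrreducibleVariety_image e hV hZ,
      isHypersurfaceWithEquation_image e (one_le_degN hk) hhom hirr.ne_zero hdvd hZ⟩
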